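/- **Lemma.** Let $\mathcal S\subseteq\mathcal P(\mathbb N)$ be a Scott set, i.e. a nonempty family closed under join and under Turing reducibility in which every infinite tree $Tr\subseteq 2^{<\omega}$, $Tr\in\mathcal S$, has an infinite path in $\mathcal S$. Suppose that $X\in\mathcal S$ and $X'\notin\mathcal S$ for some $X$, where $X'$ is the Turing jump of $X$. Then "Effectively Prime $\Rightarrow$ Effectively Atomic" does not hold in $\mathcal S$, viewed as the second-order part of a standard model of second-order arithmetic. That is, the following statement fails: for every language $\mathcal L\in\mathcal S$, every complete $\mathcal L$-theory $T$ whose set of consequences is in $\mathcal S$, and every model $\mathcal A\models T$ in $\mathcal S$ that is prime in $\mathcal S$, the model $\mathcal A$ is effectively atomic in $\mathcal S$. Here a model $\mathcal A$ in $\mathcal S$ is a structure whose domain is a nonempty set of natural numbers and whose domain and complete diagram are in $\mathcal S$ (under a Gödel numbering); $\mathcal A\models T$ is *prime in $\mathcal S$* if for every model $\mathcal M\models T$ in $\mathcal S$ some elementary embedding of $\mathcal A$ into $\mathcal M$ is in $\mathcal S$; it is *effectively atomic in $\mathcal S$* if some function $g\in\mathcal S$ maps every tuple $\vec a$ of $\mathcal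 A$ (of any length) to a formula $\varphi(\vec x)$ with $\mathcal A\models\varphi(\vec a)$ that is complete, i.e. such that for every $\psi(\vec x)$ exactly one of $T\vdash\varphi\to\psi$, $T\vdash\varphi\to\neg\psi$ holds. A witness is the following theory $T^X$ in the language with unary relation symbols $R_i$, $R_{i,s}$ ($i,s\in\mathbb N$). Its axioms say that the $R_i$ are pairwise disjoint sets with exactly two elements each; that $R_{i,s}\subseteq R_i$, and $R_{i,s}\subseteq R_{i,t}$ for $s\le t$; that $R_{i,s}=\emptyset$ if the computation $\Phi_i^X(i)$ has not converged within $s$ steps; and that one element of $R_i$ is in $R_{i,s}$ and another is not, if $\Phi_i^X(i)$ has converged within $s$ steps. The language of $T^X$ is in $\mathcal S$, the theory $T^X$ is complete, its set of consequences is in $\mathcal S$, and $T^X$ has a prime model (in the classical sense) that is a model in $\mathcal S$, is prime in $\mathcal S$, and is not effectively atomic in $\mathcal S$. -/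

import Mathlib

namespace ScottModels

open FirstOrder FirstOrder.Language

/-! ### Turing reducibility, the jump, Scott sets -/

open Classical in
/-- The characteristic function of a set of natural numbers. -/
noncomputable def charFn (X : Set ℕ) : ℕ → ℕ := fun n => if n ∈ X then 1 else 0

/-- `Y` is Turing reducible to `X`. -/
def SetReducible (Y X : Set ℕ) : Prop :=
  TuringReducible (fun n => Part.some (charFn Y n)) (fun n => Part.some (charFn X n))

/-- The Turing join `X ⊕ Y`. -/
def join (X Y : Set ℕ) : Set ℕ :=
  {k | ∃ n ∈ X, k = 2 * n} ∪ {k | ∃ n ∈ Y, k = 2 * n + 1}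

open Classical in
/-- The initial segment of length `n` of the characteristic sequence of `X`. -/
noncomputable def initSeg (X : Set ℕ) (n : ℕ) : List Bool :=
  (List.range n).map fun i => decide (i ∈ X)

/-- `Φ_{e,s}^X(n)↓`: the `e`-th oracle computation with oracle `X` and input `n` halts within `s`
steps. The `e`-th program is run for `s` steps on `n` together with a finite initial segment of the
oracle, of length at most `s`; the sets `{n | ∃ s, HaltsBy X e n s}`, `e ∈ ℕ`, are (uniformly) all
the sets which are computably enumerable in `X`. -/
def HaltsBy (X : Set ℕ) (e n s : ℕ) : Prop :=
  ∃ t ≤ s, (Nat.Partrec.Code.evaln s (Denumerable.ofNat Nat.Partrec.Code e)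
    (Nat.pair n (Encodable.encode (initSeg X t)))).isSome

/-- The Turing jump `X' = {e | Φ_e^X(e)↓}`. -/
def jump (X : Set ℕ) : Set ℕ := {e | ∃ s, HaltsBy X e e s}

/-- A Scott set: a nonempty family of sets of natural numbers closed under join and under Turing
reducibility, in which every infinite binary tree of the family has an infinite path. -/
structure IsScottSet (S : Set (Set ℕ)) : Prop where
  nonempty : S.Nonempty
  join_mem : ∀ X ∈ S, ∀ Y ∈ S, join X Y ∈ S
  reducible_mem : ∀ X ∈ S, ∀ Y, SetReducible Y X → Y ∈ S
  path_mem : ∀ Tr : Set (List Bool),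
    (∀ σ ∈ Tr, ∀ τ : List Bool, τ <+: σ → τ ∈ Tr) → Tr.Infinite →
    {c | ∃ σ ∈ Tr, c = Encodable.encode σ} ∈ S →
    ∃ P ∈ S, ∀ n, initSeg P n ∈ Tr

/-! ### Gödel numbering -/

/-- A numbering of the symbols of a language (injective in each arity). -/
class NumberedLanguage (L : FirstOrder.Language.{0, 0}) where
  funCode : ∀ n, L.Functions n → ℕ
  relCode : ∀ n, L.Relations n → ℕ
  funCode_injective : ∀ n, Function.Injective (funCode n)
  relCode_injective : ∀ n, Function.Injective (relCode n)

variable {L : FirstOrder.Language.{0, 0}} [NumberedLanguage L]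

/-- The Gödel number of a term, given numbers for its variables. -/
def termCode {α : Type} (v : α → ℕ) : L.Term α → ℕ
  | .var a => Nat.pair 0 (v a)
  | @Term.func _ _ n f ts => Nat.pair 1 (Nat.pair (Nat.pair n (NumberedLanguage.funCode n f))
      (Encodable.encode (List.ofFn fun i => termCode v (ts i))))

/-- The numbering of the variables of a bounded formula: free variables get even numbers and
quantified variables get odd numbers. -/
def varCode {α : Type} (v : α → ℕ) {n : ℕ} : α ⊕ Fin n → ℕ :=
  Sum.elim (fun a => 2 * v a) (fun i => 2 * (i : ℕ) + 1)

/-- The Gödel number of a formula, given numbers for its free variables. -/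
def bdCode {α : Type} (v : α → ℕ) : ∀ {n : ℕ}, L.BoundedFormula α n → ℕ
  | _, .falsum => Nat.pair 0 0
  | _, .equal t₁ t₂ => Nat.pair 1 (Nat.pair (termCode (varCode v) t₁) (termCode (varCode v) t₂))
  | _, @BoundedFormula.rel _ _ _ l R ts =>
      Nat.pair 2 (Nat.pair (Nat.pair l (NumberedLanguage.relCode l R))
        (Encodable.encode (List.ofFn fun i => termCode (varCode v) (ts i))))
  | _, .imp φ ψ => Nat.pair 3 (Nat.pair (bdCode v φ) (bdCode v ψ))
  | _, .all φ => Nat.pair 4 (bdCode v φ)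

/-- The Gödel number of a formula in the free variables `x₀, …, x_{n-1}`. -/
def formulaCode {n : ℕ} (φ : L.Formula (Fin n)) : ℕ := bdCode (fun i : Fin n => (i : ℕ)) φ

/-- The Gödel number of a sentence. -/
def sentenceCode (φ : L.Sentence) : ℕ := bdCode (fun e : Empty => e.elim) φ

/-- The code of a finite tuple of natural numbers. -/
def tupleCode {n : ℕ} (a : Fin n → ℕ) : ℕ := Encodable.encode (List.ofFn a)

/-! ### Languages, theories and models in a family `S` of sets of natural numbers -/

/-- The language (its set of numbered symbols with their arities) belongs to `S`. -/
def LanguageIn (S : Set (Set ℕ)) (L : FirstOrder.Language.{0, 0}) [NumberedLanguage L] : Prop :=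
  {c | ∃ n, ∃ f : L.Functions n, c = Nat.pair n (NumberedLanguage.funCode n f)} ∈ S ∧
  {c | ∃ n, ∃ R : L.Relations n, c = Nat.pair n (NumberedLanguage.relCode n R)} ∈ S

/-- `T` is decidable in `S`: its set of consequences belongs to `S`. -/
def TheoryDecidableIn (S : Set (Set ℕ)) (T : L.Theory) : Prop :=
  {c | ∃ φ : L.Sentence, T ⊨ᵇ φ ∧ c = sentenceCode φ} ∈ S

/-- A (nonempty) structure whose domain is a set of natural numbers. -/
structure NatModel (L : FirstOrder.Language.{0, 0}) where
  dom : Set ℕ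
  dom_nonempty : dom.Nonempty
  str : L.Structure dom

instance (A : NatModel L) : L.Structure A.dom := A.str

instance (A : NatModel L) : Nonempty A.dom := A.dom_nonempty.to_subtype

/-- The complete (elementary) diagram of `A`, as a set of natural numbers. -/
def diagram (A : NatModel L) : Set ℕ :=
  {c | ∃ n, ∃ (φ : L.Formula (Fin n)) (a : Fin n → A.dom),
    φ.Realize a ∧ c = Nat.pair (formulaCode φ) (tupleCode fun i => (a i : ℕ))}

/-- `A` is a decidable model in `S`: its domain and its complete diagram belong to `S`. -/
def ModelIn (S : Set (Set ℕ)) (A : NatModel L) : Prop := A.dom ∈ S ∧ diagram A ∈ S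

/-- `A` is a prime model of `T` (in the classical sense). -/
def IsPrimeModel (T : L.Theory) (A : NatModel L) : Prop :=
  A.dom ⊨ T ∧ ∀ (M : Type) [L.Structure M] [Nonempty M], M ⊨ T → Nonempty (A.dom ↪ₑ[L] M)

/-- `A` is prime within `S`: it embeds elementarily, by a function in `S`, into every model of `T`
in `S`. -/
def EffectivelyPrimeIn (S : Set (Set ℕ)) (T : L.Theory) (A : NatModel L) : Prop :=
  ∀ M : NatModel L, M.dom ⊨ T → ModelIn S M →
    ∃ f : A.dom ↪ₑ[L] M.dom, {c | ∃ a : A.dom, c = Nat.pair (a : ℕ) (f a : ℕ)} ∈ S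

/-- `φ` is a complete formula of `T`. -/
def IsCompleteFormula (T : L.Theory) {n : ℕ} (φ : L.Formula (Fin n)) : Prop :=
  ∀ ψ : L.Formula (Fin n), Xor (T ⊨ᵇ φ.imp ψ) (T ⊨ᵇ φ.imp ψ.not)

/-- `A` is effectively atomic within `S`: some function in `S` takes every tuple of `A`, of any
length, to a complete formula of `T` which is satisfied by the tuple. -/
def EffectivelyAtomicIn (S : Set (Set ℕ)) (T : L.Theory) (A : NatModel L) : Prop :=
  ∃ g : ℕ → ℕ, {c | ∃ x, c = Nat.pair x (g x)} ∈ S ∧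
    ∀ (n : ℕ) (a : Fin n → A.dom), ∃ φ : L.Formula (Fin n),
      g (tupleCode fun i => (a i : ℕ)) = formulaCode φ ∧ IsCompleteFormula T φ ∧ φ.Realize a

/-- "Effectively Prime ⇒ Effectively Atomic" holds in the standard model of second order
arithmetic with second order part `S`. -/
def EffectivelyPrimeImpliesAtomicIn (S : Set (Set ℕ)) : Prop :=
  ∀ (L : FirstOrder.Language.{0, 0}) [NumberedLanguage L], LanguageIn S L →
    ∀ T : L.Theory, T.IsComplete → TheoryDecidableIn S T →
      ∀ A : NatModel L, A.dom ⊨ T → ModelIn S A →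
        EffectivelyPrimeIn S T A → EffectivelyAtomicIn S T A

/-! ### The theory relativized to `X` -/

/-- The unary relation symbols `R_i` and `R_{i,s}`. -/
inductive HaltRel : ℕ → Type
  | block (i : ℕ) : HaltRel 1
  | stage (i s : ℕ) : HaltRel 1

/-- The language with relation symbols `R_i` and `R_{i,s}` and no function symbols. -/
def haltLang : FirstOrder.Language.{0, 0} := ⟨fun _ => Empty, HaltRel⟩

/-- `R_i` has number `2 i`, and `R_{i,s}` has number `2 ⟨i, s⟩ + 1`. -/
def haltRelCode : ∀ n, HaltRel n → ℕ
  | _, .block i => 2 * i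
  | _, .stage i s => 2 * Nat.pair i s + 1

theorem haltRelCode_injective (n : ℕ) : Function.Injective (haltRelCode n) := by
  intro a b h
  cases a <;> cases b <;> simp only [haltRelCode] at h
  · congr 1; omega
  · omega
  · omega
  · rename_i i s j t
    have h2 := Nat.pair_eq_pair.mp (show Nat.pair i s = Nat.pair j t by omega)
    rw [h2.1, h2.2]

instance : NumberedLanguage haltLang where
  funCode _ f := Empty.elim f
  relCode := haltRelCode
  funCode_injective _ f := Empty.elim f
  relCode_injective := haltRelCode_injective

/-- The atomic formula `R_i(t)`. -/
def inBlock (i : ℕ) {n : ℕ} (t : haltLang.Term (Empty ⊕ Fin n)) :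
    haltLang.BoundedFormula Empty n :=
  Relations.boundedFormula₁ (L := haltLang) (HaltRel.block i) t

/-- The atomic formula `R_{i,s}(t)`. -/
def inStage (i s : ℕ) {n : ℕ} (t : haltLang.Term (Empty ⊕ Fin n)) :
    haltLang.BoundedFormula Empty n :=
  Relations.boundedFormula₁ (L := haltLang) (HaltRel.stage i s) t

/-- The axioms of the theory `T^X`. -/
inductive HaltAxiom (X : Set ℕ) : haltLang.Sentence → Prop
  /-- The `R_i` are pairwise disjoint. -/
  | disjoint (i j : ℕ) (h : i ≠ j) : HaltAxiom X (∀' (inBlock i (&0) ⟹ ∼(inBlock j (&0))))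
  /-- Each `R_i` has exactly two elements. -/
  | two (i : ℕ) : HaltAxiom X (∃' ∃' (∼((&0) =' (&1)) ⊓ inBlock i (&0) ⊓ inBlock i (&1) ⊓
      ∀' (inBlock i (&2) ⟹ ((&2) =' (&0) ⊔ (&2) =' (&1)))))
  /-- `R_{i,s}` is contained in `R_i`. -/
  | sub (i s : ℕ) : HaltAxiom X (∀' (inStage i s (&0) ⟹ inBlock i (&0)))
  /-- `R_{i,s}` is contained in `R_{i,t}` for `s ≤ t`. -/
  | mono (i s t : ℕ) (h : s ≤ t) : HaltAxiom X (∀' (inStage i s (&0) ⟹ inStage i t (&0)))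
  /-- If `Φ_{i,s}^X(i)` diverges, then `R_{i,s}` is empty. -/
  | empty (i s : ℕ) (h : ¬ HaltsBy X i i s) : HaltAxiom X (∀' ∼(inStage i s (&0)))
  /-- If `Φ_{i,s}^X(i)` converges, then one element of `R_i` is in `R_{i,s}` and another is not. -/
  | split (i s : ℕ) (h : HaltsBy X i i s) : HaltAxiom X
      (∃' ∃' (inBlock i (&0) ⊓ inBlock i (&1) ⊓ inStage i s (&0) ⊓ ∼(inStage i s (&1))))

/-- The theory `T^X`. -/
def haltTheory (X : Set ℕ) : haltLang.Theory := {φ | HaltAxiom X φ}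

end ScottModels

/-!
The standard model of `T^X` has domain `ℕ`, blocks `R_i = {2 i, 2 i + 1}`, and `R_{i,s} = {2 i + 1}`
as soon as `Φ_i^X(i)` has converged within `s` steps. One observation is used throughout
(`realize_perm`): a formula contains only symbols whose number is smaller than its Gödel number, so
its truth is preserved by every permutation that preserves the relations of smaller number.

*Completeness and primality.* A map from `ℕ` to a model of `T^X` that sends `2 i` and `2 i + 1` to
the two elements of `R_i`, the former outside all `R_{i,s}`, is an elementary embedding
(`exists_elementaryEmbedding`). The Tarski–Vaught test asks only about elements outside all blocks,
and a given formula does not distinguish these from elements of blocks of large index. Such a map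
always exists, so the standard model is prime and `T^X` is complete.

*Decidability.* In the standard model, an element of a block not mentioned in a formula can be
exchanged with any other such element. Quantifiers may therefore be bounded, by a number computed
from the formula and its parameters, and truth can be tabulated by primitive recursion on Gödel
numbers from a finite initial segment of `X` (`mem_evalTable_false_iff`, `segDecidable_truth`). So
the theory and the complete diagram of the standard model are computable in `X`.

*Primality in the Scott set.* For a model in the Scott set, the two elements of `R_i` can be found,
but it cannot be decided which of them enters some `R_{i,s}`. The strings that have not yet been
seen to guess wrongly form an infinite binary tree (`choiceTree`), computable in the diagram of the
model, and a path through it in the Scott set gives the elementary embedding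
(`haltModel_effectivelyPrimeIn`).

*No effective atomicity.* If a complete formula satisfied by `2 i + 1` contained only symbols
`R_{i,s}` for which `R_{i,s}` is empty although `Φ_i^X(i)` converges, the exchange of `2 i` and
`2 i + 1` would preserve it. Hence its Gödel number bounds the halting time
(`haltsBy_formulaCode`), and a function assigning complete formulas to tuples computes, together
with `X`, the jump of `X`.

Turing reductions are obtained from a stronger notion, `SegDecidable`, which needs only Mathlib's
theory of (unrelativized) primitive recursive functions: the predicate is decided, primitive
recursively, by any initial segment of the oracle of a length bounded in advance.
-/

namespace ScottModels

open FirstOrder FirstOrder.Language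

/-! ### Deciding sets from finite pieces of an oracle -/

theorem length_initSeg (X : Set ℕ) (n : ℕ) : (initSeg X n).length = n := by
  simp [initSeg]

theorem initSeg_succ (X : Set ℕ) (n : ℕ) :
    initSeg X (n + 1) = initSeg X n ++ [decide (charFn X n = 1)] := by
  by_cases h : n ∈ X <;> simp [initSeg, List.range_succ, charFn, h]

theorem take_initSeg (X : Set ℕ) {m n : ℕ} (h : m ≤ n) :
    (initSeg X n).take m = initSeg X m := by
  simp [initSeg, ← List.map_take, List.take_range, h]

theorem getElem?_initSeg (X : Set ℕ) {m n : ℕ} (h : m < n) :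
    (initSeg X n)[m]? = some true ↔ m ∈ X := by
  simp [initSeg, h]

/-- The predicate `p` is decided, uniformly and primitive recursively, by all sufficiently long
initial segments of the oracle `X`, where "sufficiently long" is given by a primitive recursive
function of the argument. -/
def SegDecidable {α : Type} [Primcodable α] (X : Set ℕ) (p : α → Prop) : Prop :=
  ∃ F : α → List Bool → Prop, PrimrecRel F ∧ ∃ b : α → ℕ, Primrec b ∧
    ∀ a N, b a ≤ N → (p a ↔ F a (initSeg X N))

namespace SegDecidable

variable {α β : Type} [Primcodable α] [Primcodable β] {X : Set ℕ} {p q : α → Prop}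

theorem of_primrecPred (hp : PrimrecPred p) : SegDecidable X p :=
  ⟨fun a _ => p a, hp.comp Primrec.fst, fun _ => 0, Primrec.const 0, fun _ _ _ => Iff.rfl⟩

theorem of_iff (hp : SegDecidable X p) (h : ∀ a, q a ↔ p a) : SegDecidable X q := by
  rwa [show q = p from funext fun a => propext (h a)]

theorem comp {p : β → Prop} (hp : SegDecidable X p) {f : α → β} (hf : Primrec f) :
    SegDecidable X fun a => p (f a) := by
  obtain ⟨F, hF, b, hb, h⟩ := hp
  exact ⟨fun a σ => F (f a) σ, hF.comp (hf.comp Primrec.fst) Primrec.snd, fun a => b (f a),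
    hb.comp hf, fun a N hN => h (f a) N hN⟩

protected theorem not (hp : SegDecidable X p) : SegDecidable X fun a => ¬ p a := by
  obtain ⟨F, hF, b, hb, h⟩ := hp
  exact ⟨fun a σ => ¬ F a σ, PrimrecPred.not hF, b, hb, fun a N hN => not_congr (h a N hN)⟩

protected theorem and (hp : SegDecidable X p) (hq : SegDecidable X q) :
    SegDecidable X fun a => p a ∧ q a := by
  obtain ⟨F, hF, b, hb, h⟩ := hp
  obtain ⟨G, hG, c, hc, k⟩ := hq
  exact ⟨fun a σ => F a σ ∧ G a σ, PrimrecPred.and hF hG, fun a => b a + c a,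
    Primrec.nat_add.comp hb hc,
    fun a N hN => and_congr (h a N (le_trans (Nat.le_add_right _ _) hN))
      (k a N (le_trans (Nat.le_add_left _ _) hN))⟩

protected theorem imp (hp : SegDecidable X p) (hq : SegDecidable X q) :
    SegDecidable X fun a => p a → q a :=
  (hp.and hq.not).not.of_iff fun a => by tauto

protected theorem iff (hp : SegDecidable X p) (hq : SegDecidable X q) :
    SegDecidable X fun a => p a ↔ q a :=
  ((hp.imp hq).and (hq.imp hp)).of_iff fun _ => iff_iff_implies_and_implies

theorem _root_.ScottModels.primrec_sum_map_range {n : α → ℕ} {f : α → ℕ → ℕ}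
    (hn : Primrec n) (hf : Primrec₂ f) :
    Primrec fun a => ((List.range (n a)).map (f a)).sum :=
  Primrec.list_foldr (Primrec.list_map (Primrec.list_range.comp hn) hf) (Primrec.const 0)
    (Primrec.nat_add.comp (Primrec.fst.comp Primrec.snd) (Primrec.snd.comp Primrec.snd)).to₂

theorem forall_lt {p : α × ℕ → Prop} (hp : SegDecidable X p) {n : α → ℕ} (hn : Primrec n) :
    SegDecidable X fun a => ∀ x < n a, p (a, x) := by
  obtain ⟨F, hF, b, hb, h⟩ := hp
  have hR : PrimrecRel fun (x : ℕ) (y : α × List Bool) => F (y.1, x) y.2 :=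
    hF.comp ((Primrec.fst.comp Primrec.snd).pair Primrec.fst) (Primrec.snd.comp Primrec.snd)
  refine ⟨fun a σ => ∀ x < n a, F (a, x) σ,
    (hR.forall_mem_list.comp (Primrec.list_range.comp (hn.comp Primrec.fst)) Primrec.id).of_eq
      fun a => by simp,
    fun a => ((List.range (n a)).map fun x => b (a, x)).sum,
    primrec_sum_map_range hn hb.to₂, fun a N hN => forall₂_congr fun x hx => h _ _ ?_⟩
  exact (List.single_le_sum (by simp) _
    (List.mem_map_of_mem (f := fun x => b (a, x)) (List.mem_range.2 hx))).trans hN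

theorem exists_lt {p : α × ℕ → Prop} (hp : SegDecidable X p) {n : α → ℕ} (hn : Primrec n) :
    SegDecidable X fun a => ∃ x < n a, p (a, x) :=
  (forall_lt hp.not hn).not.of_iff fun a => by push Not; rfl

theorem mem_oracle {f : α → ℕ} (hf : Primrec f) : SegDecidable X fun a => f a ∈ X :=
  ⟨fun a σ => σ[f a]? = some true,
    Primrec.eq.comp (Primrec.list_getElem?.comp Primrec.snd (hf.comp Primrec.fst))
      (Primrec.const _),
    fun a => f a + 1, Primrec.succ.comp hf, fun _ _ hN => (getElem?_initSeg X hN).symm⟩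

end SegDecidable

theorem two_mul_mem_join {X Y : Set ℕ} {n : ℕ} : 2 * n ∈ join X Y ↔ n ∈ X := by
  refine ⟨?_, fun h => Or.inl ⟨n, h, rfl⟩⟩
  rintro (⟨m, hm, h⟩ | ⟨m, hm, h⟩)
  · rwa [show n = m by omega]
  · omega

theorem two_mul_add_one_mem_join {X Y : Set ℕ} {n : ℕ} : 2 * n + 1 ∈ join X Y ↔ n ∈ Y := by
  refine ⟨?_, fun h => Or.inr ⟨n, h, rfl⟩⟩
  rintro (⟨m, hm, h⟩ | ⟨m, hm, h⟩)
  · omega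
  · rwa [show n = m by omega]

namespace SegDecidable

variable {α : Type} [Primcodable α] {X Y : Set ℕ} {p : α → Prop}

/-- Initial segments of `X` and `Y` are extracted primitive recursively from those of the join. -/
theorem initSeg_of_join (X Y : Set ℕ) :
    ∃ f g : List Bool → ℕ → List Bool, Primrec₂ f ∧ Primrec₂ g ∧ ∀ N,
      f (initSeg (join X Y) (2 * N)) N = initSeg X N ∧
      g (initSeg (join X Y) (2 * N)) N = initSeg Y N := by
  have key : ∀ k : ℕ, k < 2 → Primrec₂ fun (σ : List Bool) (N : ℕ) =>
      (List.range N).map fun i => (σ[2 * i + k]?).getD false := fun k _ =>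
    Primrec.list_map (Primrec.list_range.comp Primrec.snd)
      (Primrec.option_getD.comp (Primrec.list_getElem?.comp
        (Primrec.fst.comp Primrec.fst)
        (Primrec.nat_add.comp (Primrec.nat_mul.comp (Primrec.const 2) Primrec.snd)
          (Primrec.const k))) (Primrec.const false)).to₂
  refine ⟨_, _, key 0 (by omega), key 1 (by omega), fun N => ⟨?_, ?_⟩⟩
  · refine List.map_congr_left fun i hi => ?_
    have : 2 * i < 2 * N := by have := List.mem_range.1 hi; omega
    simp [initSeg, this, two_mul_mem_join]
  · refine List.map_congr_left fun i hi => ?_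
    have : 2 * i + 1 < 2 * N := by have := List.mem_range.1 hi; omega
    simp [initSeg, this, two_mul_add_one_mem_join]

theorem join_left (hp : SegDecidable X p) (Y : Set ℕ) : SegDecidable (join X Y) p := by
  obtain ⟨F, hF, b, hb, h⟩ := hp
  obtain ⟨f, _, hf, _, hfg⟩ := initSeg_of_join X Y
  refine ⟨fun a σ => F a (f (σ.take (2 * b a)) (b a)), ?_, fun a => 2 * b a,
    Primrec.nat_mul.comp (Primrec.const 2) hb, fun a N hN => ?_⟩
  · have hb' : Primrec fun x : α × List Bool => b x.1 := hb.comp Primrec.fst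
    exact hF.comp Primrec.fst (hf.comp (Primrec.list_take.comp
      (Primrec.nat_mul.comp (Primrec.const 2) hb') Primrec.snd) hb')
  · change _ ↔ F a _
    rw [take_initSeg _ (show 2 * b a ≤ N from hN), (hfg _).1, h a _ le_rfl]

theorem join_right (hp : SegDecidable Y p) (X : Set ℕ) : SegDecidable (join X Y) p := by
  obtain ⟨F, hF, b, hb, h⟩ := hp
  obtain ⟨_, g, _, hg, hfg⟩ := initSeg_of_join X Y
  refine ⟨fun a σ => F a (g (σ.take (2 * b a)) (b a)), ?_, fun a => 2 * b a,
    Primrec.nat_mul.comp (Primrec.const 2) hb, fun a N hN => ?_⟩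
  · have hb' : Primrec fun x : α × List Bool => b x.1 := hb.comp Primrec.fst
    exact hF.comp Primrec.fst (hg.comp (Primrec.list_take.comp
      (Primrec.nat_mul.comp (Primrec.const 2) hb') Primrec.snd) hb')
  · change _ ↔ F a _
    rw [take_initSeg _ (show 2 * b a ≤ N from hN), (hfg _).2, h a _ le_rfl]

end SegDecidable

/-! ### From segment decidability to Turing reducibility -/

theorem recursiveIn_comp_total {O : Set (ℕ →. ℕ)} {f g : ℕ → ℕ}
    (hf : Nat.RecursiveIn O fun n => Part.some (f n))
    (hg : Nat.RecursiveIn O fun n => Part.some (g n)) :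
    Nat.RecursiveIn O fun n => Part.some (f (g n)) :=
  (hf.comp hg).of_eq fun n => by simp [Part.bind_eq_bind]

theorem recursiveIn_pair_total {O : Set (ℕ →. ℕ)} {f g : ℕ → ℕ}
    (hf : Nat.RecursiveIn O fun n => Part.some (f n))
    (hg : Nat.RecursiveIn O fun n => Part.some (g n)) :
    Nat.RecursiveIn O fun n => Part.some (Nat.pair (f n) (g n)) :=
  (hf.pair hg).of_eq fun n => by simp [Seq.seq]

theorem recursiveIn_of_primrec {O : Set (ℕ →. ℕ)} {f : ℕ → ℕ} (hf : Primrec f) :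
    Nat.RecursiveIn O fun n => Part.some (f n) :=
  (Primrec.nat_iff.1 hf).recursiveIn

theorem recursiveIn_encode_initSeg (X : Set ℕ) :
    Nat.RecursiveIn {fun n => Part.some (charFn X n)}
      fun n => Part.some (Encodable.encode (initSeg X n)) := by
  have step : Primrec fun m : ℕ => Encodable.encode
      ((Encodable.decode (α := List Bool) m.unpair.1).getD [] ++
        [decide (m.unpair.2 = 1)]) := by
    refine Primrec.encode.comp (Primrec.list_append.comp (Primrec.option_getD.comp
      (Primrec.decode.comp (Primrec.fst.comp Primrec.unpair)) (Primrec.const []))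
      (Primrec.list_cons.comp (PrimrecPred.decide (Primrec.eq.comp
        (Primrec.snd.comp Primrec.unpair) (Primrec.const 1))) (Primrec.const [])))
  have h1 : Nat.RecursiveIn {fun n => Part.some (charFn X n)}
      fun q : ℕ => Part.some (Nat.pair q.unpair.2.unpair.2 (charFn X q.unpair.2.unpair.1)) :=
    recursiveIn_pair_total
      (recursiveIn_of_primrec (Primrec.snd.comp (Primrec.unpair.comp
        (Primrec.snd.comp Primrec.unpair))))
      (recursiveIn_comp_total (f := charFn X) (.oracle _ rfl)
        (recursiveIn_of_primrec (Primrec.fst.comp (Primrec.unpair.comp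
          (Primrec.snd.comp Primrec.unpair)))))
  have h2 := Nat.RecursiveIn.prec
    (recursiveIn_of_primrec (Primrec.const (Encodable.encode ([] : List Bool))))
    (recursiveIn_comp_total (recursiveIn_of_primrec step) h1)
  refine (h2.comp (recursiveIn_of_primrec (f := fun n => Nat.pair 0 n)
    (Primrec₂.natPair.comp (Primrec.const 0) Primrec.id))).of_eq fun n => ?_
  simp only [Part.bind_eq_bind, Part.bind_some, Nat.unpair_pair]
  induction n with
  | zero => simp [initSeg]
  | succ n ih => simp only [ih, Part.bind_some, Encodable.encodek,
      Option.getD_some, initSeg_succ]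

theorem SegDecidable.recursiveIn {X : Set ℕ} {p : ℕ → Prop} (hp : SegDecidable X p) :
    Nat.RecursiveIn {fun n => Part.some (charFn X n)}
      fun n => Part.some (charFn {n | p n} n) := by
  obtain ⟨F, hF, b, hb, h⟩ := hp
  obtain ⟨hdec, hF⟩ := hF
  have hH : Primrec fun m : ℕ => bif decide
      ((fun a : ℕ × List Bool => F a.1 a.2)
        (m.unpair.1, (Encodable.decode (α := List Bool) m.unpair.2).getD [])) then 1 else 0 :=
    Primrec.cond (hF.comp ((Primrec.fst.comp Primrec.unpair).pair (Primrec.option_getD.comp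
      (Primrec.decode.comp (Primrec.snd.comp Primrec.unpair)) (Primrec.const []))))
      (Primrec.const 1) (Primrec.const 0)
  refine (recursiveIn_comp_total (recursiveIn_of_primrec hH) (recursiveIn_pair_total
    (recursiveIn_of_primrec Primrec.id) (recursiveIn_comp_total (recursiveIn_encode_initSeg X)
      (recursiveIn_of_primrec hb)))).of_eq fun n => ?_
  have := h n (b n) le_rfl
  by_cases hn : p n
  · simp [charFn, hn, this.1 hn]
  · simp [charFn, hn, mt this.2 hn]

theorem SegDecidable.setReducible {X : Set ℕ} {p : ℕ → Prop} (hp : SegDecidable X p) :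
    SetReducible {n | p n} X :=
  RecursiveIn.iff_nat.2 hp.recursiveIn

/-- Unbounded search: a set is reducible to `X` if membership of `n` can be read off from any `y`
with `p n y`, and such a `y` always exists. -/
theorem SegDecidable.setReducible_of_search {X Y : Set ℕ} {p q : ℕ × ℕ → Prop}
    (hp : SegDecidable X p) (hq : SegDecidable X q) (hex : ∀ n, ∃ y, p (n, y))
    (hY : ∀ n y, p (n, y) → (n ∈ Y ↔ q (n, y))) : SetReducible Y X := by
  have hp' := (SegDecidable.not (hp.comp Primrec.unpair)).recursiveIn
  have hq' := (hq.comp Primrec.unpair).recursiveIn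
  refine RecursiveIn.iff_nat.2 ((hq'.comp ((recursiveIn_of_primrec Primrec.id).pair
    hp'.rfind)).of_eq_tot fun n => ?_)
  have hdom : ∃ y, y ∈ Nat.rfind fun k => Part.map (fun m => decide (m = 0))
      (Part.some (charFn {m | ¬ p m.unpair} (Nat.pair n k))) := by
    obtain ⟨y, hy⟩ := hex n
    exact Part.dom_iff_mem.1 (Nat.rfind_dom.2 ⟨y, by simp [charFn, hy]⟩)
  obtain ⟨y, hy⟩ := hdom
  have hy' : p (n, y) := by
    have := Nat.rfind_spec hy
    by_contra hc
    simp [charFn, hc] at this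
  have : charFn Y n = charFn {m | q m.unpair} (Nat.pair n y) := by
    by_cases h : q (n, y) <;> simp [charFn, hY n y hy', h]
  rw [this]
  refine Part.mem_bind (a := Nat.pair n y) ?_ (Part.mem_some _)
  have hy := Part.eq_some_iff.2 hy
  change _ ∈ (Part.map Nat.pair (Part.some n)).bind fun f => Part.map f (Nat.rfind _)
  rw [Part.map_some, Part.bind_some]
  exact Part.mem_map_iff _ |>.2 ⟨y, Part.eq_some_iff.1 hy, rfl⟩

namespace IsScottSet

variable {S : Set (Set ℕ)}

theorem mem_of_segDecidable (hS : IsScottSet S) {X : Set ℕ} (hX : X ∈ S) {p : ℕ → Prop}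
    (hp : SegDecidable X p) : {n | p n} ∈ S :=
  hS.reducible_mem X hX _ hp.setReducible

theorem mem_of_primrecPred (hS : IsScottSet S) {p : ℕ → Prop} (hp : PrimrecPred p) :
    {n | p n} ∈ S := by
  obtain ⟨X, hX⟩ := hS.nonempty
  exact hS.mem_of_segDecidable hX (SegDecidable.of_primrecPred hp)

end IsScottSet

/-! ### The standard model of `T^X` -/

/-- The standard model of `T^X`: the domain is `ℕ`, the block `R_i` is `{2 i, 2 i + 1}`, and
`R_{i,s}` is `{2 i + 1}` or empty. -/
def haltModel (X : Set ℕ) : NatModel haltLang where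
  dom := Set.univ
  dom_nonempty := ⟨0, trivial⟩
  str :=
    { funMap := fun f => Empty.elim f
      RelMap := fun {n} (r : HaltRel n) => match r with
        | .block i => fun xs => (xs 0 : ℕ) / 2 = i
        | .stage i s => fun xs => (xs 0 : ℕ) = 2 * i + 1 ∧ HaltsBy X i i s }

/-- The natural number `n` as an element of the standard model. -/
def haltModel.mk (X : Set ℕ) (n : ℕ) : (haltModel X).dom := ⟨n, trivial⟩

/-- Membership of `x` in the relation `R_i` of a structure. -/
def Block {M : Type} [haltLang.Structure M] (i : ℕ) (x : M) : Prop :=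
  Structure.RelMap (L := haltLang) (HaltRel.block i) ![x]

/-- Membership of `x` in the relation `R_{i,s}` of a structure. -/
def Stage {M : Type} [haltLang.Structure M] (i s : ℕ) (x : M) : Prop :=
  Structure.RelMap (L := haltLang) (HaltRel.stage i s) ![x]

theorem realize_inBlock {M : Type} [haltLang.Structure M] {i n : ℕ}
    {t : haltLang.Term (Empty ⊕ Fin n)} {v : Empty → M} {xs : Fin n → M} :
    (inBlock i t).Realize v xs ↔ Block i (t.realize (Sum.elim v xs)) :=
  BoundedFormula.realize_rel₁

theorem realize_inStage {M : Type} [haltLang.Structure M] {i s n : ℕ}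
    {t : haltLang.Term (Empty ⊕ Fin n)} {v : Empty → M} {xs : Fin n → M} :
    (inStage i s t).Realize v xs ↔ Stage i s (t.realize (Sum.elim v xs)) :=
  BoundedFormula.realize_rel₁

theorem haltModel.block_iff {X : Set ℕ} {i : ℕ} {x : (haltModel X).dom} :
    Block i x ↔ (x : ℕ) / 2 = i := Iff.rfl

theorem haltModel.stage_iff {X : Set ℕ} {i s : ℕ} {x : (haltModel X).dom} :
    Stage i s x ↔ (x : ℕ) = 2 * i + 1 ∧ HaltsBy X i i s := Iff.rfl

theorem HaltsBy.mono {X : Set ℕ} {e n s t : ℕ} (h : HaltsBy X e n s) (hst : s ≤ t) :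
    HaltsBy X e n t := by
  obtain ⟨r, hr, h⟩ := h
  refine ⟨r, hr.trans hst, ?_⟩
  obtain ⟨y, hy⟩ := Option.isSome_iff_exists.1 h
  exact Option.isSome_iff_exists.2 ⟨y, Nat.Partrec.Code.evaln_mono hst hy⟩

/-- The content of `T^X`, as first order conditions on a structure. -/
theorem model_haltTheory_iff {X : Set ℕ} {M : Type} [haltLang.Structure M] :
    M ⊨ haltTheory X ↔
      (∀ i j, i ≠ j → ∀ x : M, Block i x → ¬ Block j x) ∧
      (∀ i, ∃ x y : M, x ≠ y ∧ Block i x ∧ Block i y ∧ ∀ z : M, Block i z → z = x ∨ z = y) ∧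
      (∀ i s, ∀ x : M, Stage i s x → Block i x) ∧
      (∀ i s t, s ≤ t → ∀ x : M, Stage i s x → Stage i t x) ∧
      (∀ i s, ¬ HaltsBy X i i s → ∀ x : M, ¬ Stage i s x) ∧
      (∀ i s, HaltsBy X i i s →
        ∃ x y : M, Block i x ∧ Block i y ∧ Stage i s x ∧ ¬ Stage i s y) := by
  have hall : M ⊨ haltTheory X ↔ ∀ φ, HaltAxiom X φ → M ⊨ φ := Theory.model_iff _
  rw [hall]
  constructor
  · intro h
    refine ⟨fun i j hij => ?_, fun i => ?_, fun i s => ?_, fun i s t hst => ?_, fun i s hs => ?_,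
      fun i s hs => ?_⟩
    · simpa [Sentence.Realize, Formula.Realize, realize_inBlock, realize_inStage, Fin.snoc]
        using h _ (.disjoint i j hij)
    · simpa [Sentence.Realize, Formula.Realize, realize_inBlock, realize_inStage, Fin.snoc,
        and_assoc]
        using h _ (.two i)
    · simpa [Sentence.Realize, Formula.Realize, realize_inBlock, realize_inStage, Fin.snoc]
        using h _ (.sub i s)
    · simpa [Sentence.Realize, Formula.Realize, realize_inBlock, realize_inStage, Fin.snoc]
        using h _ (.mono i s t hst)
    · simpa [Sentence.Realize, Formula.Realize, realize_inBlock, realize_inStage, Fin.snoc]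
        using h _ (.empty i s hs)
    · simpa [Sentence.Realize, Formula.Realize, realize_inBlock, realize_inStage, Fin.snoc,
        and_assoc]
        using h _ (.split i s hs)
  · rintro ⟨h1, h2, h3, h4, h5, h6⟩ φ hφ
    cases hφ with
    | disjoint i j hij =>
      simpa [Sentence.Realize, Formula.Realize, realize_inBlock, realize_inStage, Fin.snoc]
        using h1 i j hij
    | two i =>
      simpa [Sentence.Realize, Formula.Realize, realize_inBlock, realize_inStage, Fin.snoc,
        and_assoc]
        using h2 i
    | sub i s =>
      simpa [Sentence.Realize, Formula.Realize, realize_inBlock, realize_inStage, Fin.snoc]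
        using h3 i s
    | mono i s t hst =>
      simpa [Sentence.Realize, Formula.Realize, realize_inBlock, realize_inStage, Fin.snoc]
        using h4 i s t hst
    | empty i s hs =>
      simpa [Sentence.Realize, Formula.Realize, realize_inBlock, realize_inStage, Fin.snoc]
        using h5 i s hs
    | split i s hs =>
      simpa [Sentence.Realize, Formula.Realize, realize_inBlock, realize_inStage, Fin.snoc,
        and_assoc]
        using h6 i s hs

theorem haltModel_model (X : Set ℕ) : (haltModel X).dom ⊨ haltTheory X := by
  refine model_haltTheory_iff.2 ⟨fun i j hij x h k => hij (h.symm.trans k), fun i => ?_,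
    fun i s x h => ?_, fun i s t hst x h => ⟨h.1, h.2.mono hst⟩, fun i s hs x h => hs h.2,
    fun i s hs => ?_⟩
  · refine ⟨haltModel.mk X (2 * i), haltModel.mk X (2 * i + 1), fun h => ?_, ?_, ?_,
      fun z hz => ?_⟩
    · have := congrArg Subtype.val h
      simp [haltModel.mk] at this
    · rw [haltModel.block_iff]; simp [haltModel.mk]
    · rw [haltModel.block_iff]; simp only [haltModel.mk]; omega
    · rw [haltModel.block_iff] at hz
      have : (z : ℕ) = 2 * i ∨ (z : ℕ) = 2 * i + 1 := by omega
      exact this.imp Subtype.ext Subtype.ext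
  · rw [haltModel.stage_iff] at h; rw [haltModel.block_iff]; omega
  · refine ⟨haltModel.mk X (2 * i + 1), haltModel.mk X (2 * i), ?_, ?_, ⟨rfl, hs⟩, fun h => ?_⟩
    · rw [haltModel.block_iff]; simp only [haltModel.mk]; omega
    · rw [haltModel.block_iff]; simp [haltModel.mk]
    · have := h.1
      simp [haltModel.mk] at this

/-! ### Permutations preserving finitely many symbols -/

theorem haltLang_term_eq_var {α : Type} (t : haltLang.Term α) : ∃ a, t = .var a := by
  cases t with
  | var a => exact ⟨a, rfl⟩
  | func f ts => exact Empty.elim f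

/-- A permutation preserving all relations with a number at most `c` preserves every formula with
Gödel number at most `c`: a formula contains only symbols with a smaller number. -/
theorem realize_perm {M : Type} [haltLang.Structure M] (π : Equiv.Perm M) {c : ℕ}
    (hπ : ∀ (r : HaltRel 1) (x : M), haltRelCode 1 r ≤ c →
      (Structure.RelMap (L := haltLang) r ![π x] ↔ Structure.RelMap (L := haltLang) r ![x]))
    {α : Type} (v : α → ℕ) {n : ℕ} (φ : haltLang.BoundedFormula α n) (hφ : bdCode v φ ≤ c)
    (a : α → M) (xs : Fin n → M) :
    φ.Realize (fun i => π (a i)) (fun i => π (xs i)) ↔ φ.Realize a xs := by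
  have hvar : ∀ {n : ℕ} (xs : Fin n → M) (u : α ⊕ Fin n),
      Sum.elim (fun i => π (a i)) (fun i => π (xs i)) u = π (Sum.elim a xs u) := by
    rintro n xs (u | u) <;> rfl
  induction φ with
  | falsum => exact Iff.rfl
  | equal t₁ t₂ =>
    obtain ⟨u, rfl⟩ := haltLang_term_eq_var t₁
    obtain ⟨w, rfl⟩ := haltLang_term_eq_var t₂
    change Sum.elim _ _ u = Sum.elim _ _ w ↔ Sum.elim _ _ u = Sum.elim _ _ w
    rw [hvar, hvar, π.injective.eq_iff]
  | @rel n l R ts =>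
    have hR : haltRelCode l R ≤ c := (Nat.right_le_pair _ _).trans ((Nat.left_le_pair _ _).trans
      ((Nat.right_le_pair 2 _).trans hφ))
    obtain rfl : l = 1 := by cases R <;> rfl
    obtain ⟨u, hu⟩ := haltLang_term_eq_var (ts 0)
    have key : ∀ b : α ⊕ Fin n → M, (fun i => (ts i).realize b) = ![b u] := fun b => by
      funext i
      rw [Subsingleton.elim i 0, hu]
      rfl
    change Structure.RelMap R (fun i => (ts i).realize _) ↔
      Structure.RelMap R (fun i => (ts i).realize _)
    rw [key, key, hvar]
    exact hπ _ _ hR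
  | imp φ ψ ih₁ ih₂ =>
    have h : Nat.pair (bdCode v φ) (bdCode v ψ) ≤ c := (Nat.right_le_pair 3 _).trans hφ
    exact imp_congr (ih₁ ((Nat.left_le_pair _ _).trans h) xs)
      (ih₂ ((Nat.right_le_pair _ _).trans h) xs)
  | all φ ih =>
    have h : bdCode v φ ≤ c := (Nat.right_le_pair 4 _).trans hφ
    have hs : ∀ x, (Fin.snoc (fun i => π (xs i)) (π x) : Fin (_ + 1) → M) =
        fun i => π ((Fin.snoc xs x : Fin (_ + 1) → M) i) := fun x =>
      (Fin.comp_snoc π xs x).symm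
    simp only [BoundedFormula.realize_all]
    rw [← π.forall_congr_right]
    exact forall_congr' fun x => by rw [hs]; exact ih h _

/-- Exchanging two elements that satisfy the same relations with a number at most `c` preserves
every formula with Gödel number at most `c`. -/
theorem realize_snoc_congr {M : Type} [haltLang.Structure M] {c : ℕ} {x y : M}
    (hxy : ∀ r : HaltRel 1, haltRelCode 1 r ≤ c →
      (Structure.RelMap (L := haltLang) r ![x] ↔ Structure.RelMap (L := haltLang) r ![y]))
    {α : Type} (v : α → ℕ) {n : ℕ} (φ : haltLang.BoundedFormula α (n + 1)) (hφ : bdCode v φ ≤ c)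
    (a : α → M) (xs : Fin n → M) (ha : ∀ i, a i ≠ x ∧ a i ≠ y) (hxs : ∀ i, xs i ≠ x ∧ xs i ≠ y) :
    φ.Realize a (Fin.snoc xs x) ↔ φ.Realize a (Fin.snoc xs y) := by
  classical
  rw [← realize_perm (Equiv.swap x y) (c := c) ?_ v φ hφ a (Fin.snoc xs x)]
  · have h1 : (fun i => Equiv.swap x y (a i)) = a := funext fun i =>
      Equiv.swap_apply_of_ne_of_ne (ha i).1 (ha i).2
    have h2 : (fun i => Equiv.swap x y ((Fin.snoc xs x : Fin (n + 1) → M) i)) =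
        Fin.snoc xs y := by
      funext i
      refine Fin.lastCases ?_ (fun i => ?_) i
      · simp
      · simpa using Equiv.swap_apply_of_ne_of_ne (hxs i).1 (hxs i).2
    rw [h1, h2]
  · intro r z hr
    by_cases hzx : z = x
    · rw [hzx, Equiv.swap_apply_left, hxy r hr]
    by_cases hzy : z = y
    · rw [hzy, Equiv.swap_apply_right, hxy r hr]
    rw [Equiv.swap_apply_of_ne_of_ne hzx hzy]

/-! ### Elementary embeddings of the standard model -/

/-- A map of `ℕ` into a model of `T^X` is an elementary embedding of the standard model as soon as
it sends `2 i` and `2 i + 1` to the two elements of `R_i`, with the image of `2 i` outside all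
`R_{i,s}`. By the Tarski–Vaught test only elements outside the range need attention; these lie in
no block, so no formula tells them from the image of an element of a block of large index. -/
theorem exists_elementaryEmbedding {X : Set ℕ} {M : Type} [haltLang.Structure M]
    (hM : M ⊨ haltTheory X) (f : ℕ → M) (hf₀ : ∀ i, Block i (f (2 * i)))
    (hf₁ : ∀ i, Block i (f (2 * i + 1))) (hne : ∀ i, f (2 * i) ≠ f (2 * i + 1))
    (hs : ∀ i s, ¬ Stage i s (f (2 * i))) :
    ∃ g : (haltModel X).dom ↪ₑ[haltLang] M, ∀ x, g x = f x := by
  obtain ⟨hdisj, htwo, hsub, -, hempty, hsplit⟩ := model_haltTheory_iff.1 hM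
  have hblock : ∀ x, Block (x / 2) (f x) := fun x => by
    obtain h | h : x = 2 * (x / 2) ∨ x = 2 * (x / 2) + 1 := by omega
    · have := hf₀ (x / 2); rwa [← h] at this
    · have := hf₁ (x / 2); rwa [← h] at this
  have honly : ∀ i y, Block i y → y = f (2 * i) ∨ y = f (2 * i + 1) := by
    intro i y hy
    obtain ⟨a, b, -, -, -, hab⟩ := htwo i
    have h0 := hab _ (hf₀ i)
    have h1 := hab _ (hf₁ i)
    have h2 := hab _ hy
    have h3 := hne i
    grind
  have hblock_iff : ∀ i x, Block i (f x) ↔ x / 2 = i := fun i x =>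
    ⟨fun h => by_contra fun hc => hdisj _ _ hc _ (hblock x) h, fun h => h ▸ hblock x⟩
  have hinj : Function.Injective f := by
    intro x y hxy
    have h : x / 2 = y / 2 := ((hblock_iff _ _).1 (hxy ▸ hblock y))
    by_contra hc
    obtain ⟨hx, hy⟩ | ⟨hx, hy⟩ : (x = 2 * (x / 2) ∧ y = 2 * (x / 2) + 1) ∨
        (y = 2 * (x / 2) ∧ x = 2 * (x / 2) + 1) := by omega
    · exact hne (x / 2) (by rw [← hy, ← hx, hxy])
    · exact hne (x / 2) (by rw [← hy, ← hx, hxy])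
  have hstage_iff : ∀ i s x, Stage i s (f x) ↔ x = 2 * i + 1 ∧ HaltsBy X i i s := by
    intro i s x
    constructor
    · intro h
      have hx := (hblock_iff _ _).1 (hsub _ _ _ h)
      refine ⟨?_, by_contra fun hc => hempty i s hc _ h⟩
      obtain hx' | hx' : x = 2 * i ∨ x = 2 * i + 1 := by omega
      · exact absurd (hx' ▸ h) (hs i s)
      · exact hx'
    · rintro ⟨rfl, h⟩
      obtain ⟨y, -, hy, -, hys, -⟩ := hsplit i s h
      rcases honly i y hy with rfl | rfl
      · exact absurd hys (hs i s)
      · exact hys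
  have hrel : ∀ {n} (r : haltLang.Relations n) (x : Fin n → (haltModel X).dom),
      Structure.RelMap r (fun i => f (x i)) ↔ Structure.RelMap r x := by
    intro n r x
    cases r with
    | block i =>
      have h : (fun i => f (x i)) = ![f (x 0)] := funext fun i => by rw [Subsingleton.elim i 0]; rfl
      rw [h]
      exact hblock_iff i (x 0)
    | stage i s =>
      have h : (fun i => f (x i)) = ![f (x 0)] := funext fun i => by rw [Subsingleton.elim i 0]; rfl
      rw [h]
      exact hstage_iff i s (x 0)
  let e : (haltModel X).dom ↪[haltLang] M :=
    { toFun := fun x => f x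
      inj' := fun x y h => Subtype.ext (hinj h)
      map_fun' := fun g => Empty.elim g
      map_rel' := hrel }
  refine ⟨e.toElementaryEmbedding fun n φ x a ha => ?_, fun x => rfl⟩
  by_cases hrange : ∃ b, e b = a
  · obtain ⟨b, rfl⟩ := hrange
    exact ⟨b, ha⟩
  have houter : ∀ i, ¬ Block i a := by
    intro i hi
    rcases honly i a hi with h | h
    · exact hrange ⟨haltModel.mk X (2 * i), h.symm⟩
    · exact hrange ⟨haltModel.mk X (2 * i + 1), h.symm⟩
  -- An element that is not a parameter and whose block has a number greater than that of `φ`.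
  obtain ⟨b, hb, hbx⟩ : ∃ b : ℕ, 2 * (bdCode (fun e : Empty => e.elim) φ + 1) ≤ b ∧
      ∀ i, (x i : ℕ) ≠ b := by
    obtain ⟨B, hB⟩ := (Set.finite_range fun i => (x i : ℕ)).bddAbove
    refine ⟨B + 1 + 2 * (bdCode (fun e : Empty => e.elim) φ + 1), by omega, fun i h => ?_⟩
    have : (x i : ℕ) ≤ B := hB ⟨i, rfl⟩
    omega
  refine ⟨haltModel.mk X b, (realize_snoc_congr (fun r hr => ?_) (fun e : Empty => e.elim) φ le_rfl
    _ _ (fun i => i.elim) (fun i => ⟨fun h => hrange ⟨x i, h⟩, fun h => ?_⟩)).1 ha⟩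
  · cases r with
    | block i =>
      refine iff_of_false (houter i) fun h => ?_
      have h1 : b / 2 = i := (hblock_iff i b).1 h
      have h2 : 2 * i ≤ _ := hr
      omega
    | stage i s =>
      refine iff_of_false (fun h => houter i (hsub _ _ _ h)) fun h => ?_
      have h1 : b = 2 * i + 1 := ((hstage_iff i s b).1 h).1
      have h2 : 2 * Nat.pair i s + 1 ≤ _ := hr
      have h3 := Nat.left_le_pair i s
      omega
  · exact hbx i (congrArg Subtype.val (e.injective h))

/-- In a model of `T^X`, some element of `R_i` is outside all the increasing sets `R_{i,s}`. -/
theorem exists_block_forall_not_stage {X : Set ℕ} {M : Type} [haltLang.Structure M]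
    (hM : M ⊨ haltTheory X) (i : ℕ) : ∃ x y : M, x ≠ y ∧ Block i x ∧ Block i y ∧
      (∀ z, Block i z → z = x ∨ z = y) ∧ ∀ s, ¬ Stage i s x := by
  obtain ⟨-, htwo, -, hmono, hempty, hsplit⟩ := model_haltTheory_iff.1 hM
  obtain ⟨x, y, hne, hx, hy, hxy⟩ := htwo i
  by_cases h : ∀ s, ¬ Stage i s x
  · exact ⟨x, y, hne, hx, hy, hxy, h⟩
  push Not at h
  obtain ⟨s, hs⟩ := h
  refine ⟨y, x, hne.symm, hy, hx, fun z hz => (hxy z hz).symm, fun t ht => ?_⟩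
  have hx' := hmono i s (max s t) (le_max_left _ _) x hs
  have hy' := hmono i t (max s t) (le_max_right _ _) y ht
  obtain ⟨-, z, -, hz, -, hz'⟩ := hsplit i _ (by_contra fun hc => hempty i _ hc x hx')
  rcases hxy z hz with rfl | rfl
  · exact hz' hx'
  · exact hz' hy'

theorem haltModel_isPrimeModel (X : Set ℕ) : IsPrimeModel (haltTheory X) (haltModel X) := by
  refine ⟨haltModel_model X, fun M _ _ hM => ?_⟩
  choose a b hne ha hb _ hs using exists_block_forall_not_stage hM
  let f : ℕ → M := fun n => if n % 2 = 0 then a (n / 2) else b (n / 2)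
  have h0 : ∀ i, f (2 * i) = a i := fun i => by simp [f]
  have h1 : ∀ i, f (2 * i + 1) = b i := fun i => by
    simp [f, Nat.add_mod, show (2 * i + 1) / 2 = i by omega]
  obtain ⟨g, -⟩ := exists_elementaryEmbedding hM f (fun i => h0 i ▸ ha i) (fun i => h1 i ▸ hb i)
    (fun i => by rw [h0, h1]; exact hne i) (fun i s => h0 i ▸ hs i s)
  exact ⟨g⟩

/-- Every model of `T^X` is an elementary extension of the standard model. -/
theorem haltTheory_isComplete (X : Set ℕ) : (haltTheory X).IsComplete := by
  have hA := haltModel_model X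
  refine ⟨Theory.Model.isSatisfiable (haltModel X).dom, fun φ => ?_⟩
  have key : ∀ M : Theory.ModelType (haltTheory X), M ⊨ φ ↔ (haltModel X).dom ⊨ φ := fun M => by
    obtain ⟨g⟩ := (haltModel_isPrimeModel X).2 M M.is_model
    exact (g.map_sentence φ).symm
  by_cases h : (haltModel X).dom ⊨ φ
  · exact Or.inl (Theory.models_sentence_iff.2 fun M => (key M).2 h)
  · exact Or.inr (Theory.models_sentence_iff.2 fun M =>
      (Sentence.realize_not M).2 fun hM => h ((key M).1 hM))

theorem haltTheory_models_iff {X : Set ℕ} {φ : haltLang.Sentence} :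
    haltTheory X ⊨ᵇ φ ↔ (haltModel X).dom ⊨ φ :=
  have := haltModel_model X
  ((haltTheory_isComplete X).realize_sentence_iff φ (haltModel X).dom).symm

/-! ### Evaluation of formulas in the standard model -/

/-- The value of the variable with number `u`, when `w` lists the values of the free variables and
`l` those of the bound variables in scope. -/
def varValue (w l : List ℕ) (u : ℕ) : Option ℕ := if u % 2 = 0 then w[u / 2]? else l[u / 2]?

/-- The program `e` halts on its own number within `s` steps, computed from a finite piece `σ` of
the oracle. -/
def HaltsIn (σ : List Bool) (e s : ℕ) : Prop :=
  ∃ t < s + 1, (Nat.Partrec.Code.evaln s (Denumerable.ofNat Nat.Partrec.Code e)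
    (Nat.pair e (Encodable.encode (σ.take t)))).isSome = true

/-- The number `x` satisfies the relation symbol with number `r` in the standard model, computed
from a finite piece `σ` of the oracle. -/
def RelHolds (σ : List Bool) (r x : ℕ) : Prop :=
  (r % 2 = 0 ∧ x / 2 = r / 2) ∨
  (r % 2 = 1 ∧ x = 2 * (r / 2).unpair.1 + 1 ∧ HaltsIn σ (r / 2).unpair.1 (r / 2).unpair.2)

/-- `c` is the Gödel number of an atomic formula all of whose variables have a value. -/
def AtomWF (w l : List ℕ) (c : ℕ) : Prop :=
  c = 0 ∨
  (c = Nat.pair 1 (Nat.pair (Nat.pair 0 c.unpair.2.unpair.1.unpair.2)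
      (Nat.pair 0 c.unpair.2.unpair.2.unpair.2)) ∧
    (varValue w l c.unpair.2.unpair.1.unpair.2).isSome = true ∧
    (varValue w l c.unpair.2.unpair.2.unpair.2).isSome = true) ∨
  (c = Nat.pair 2 (Nat.pair (Nat.pair 1 c.unpair.2.unpair.1.unpair.2)
      (Nat.pair (Nat.pair 0 (c.unpair.2.unpair.2 - 1).unpair.1.unpair.2) 0 + 1)) ∧
    (varValue w l (c.unpair.2.unpair.2 - 1).unpair.1.unpair.2).isSome = true)

/-- The atomic formula with Gödel number `c` is true. -/
def AtomTrue (σ : List Bool) (w l : List ℕ) (c : ℕ) : Prop :=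
  (c.unpair.1 = 1 ∧ varValue w l c.unpair.2.unpair.1.unpair.2 =
    varValue w l c.unpair.2.unpair.2.unpair.2) ∨
  (c.unpair.1 = 2 ∧ RelHolds σ c.unpair.2.unpair.1.unpair.2
    ((varValue w l (c.unpair.2.unpair.2 - 1).unpair.1.unpair.2).getD 0))

/-- A bound for the quantifiers in formulas with Gödel number at most `c` and with parameters `w`.
It exceeds all parameters, and there are at least `c + 1` numbers below it which are not parameters
and are larger than all elements of blocks that such a formula can mention, so that one of them is
also different from the values of the bound variables in scope. -/
def quantBound (c : ℕ) (w : List ℕ) : ℕ := 3 * c + 2 * Encodable.encode w + 3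

/-- The lists of length at most `k` of numbers below `b`. -/
def assignments (b k : ℕ) : List (List ℕ) :=
  k.rec [ [] ] fun _ r => [] :: r.flatMap fun l => (List.range b).map fun x => x :: l

/-- The data for an evaluation: a bound for the Gödel numbers, the parameters, and a finite piece
of the oracle. -/
abbrev EvalData := ℕ × List ℕ × List Bool

/-- A table with the assignments `l` for which a Gödel number is that of a well-formed formula
(entries `(true, l)`), and those for which the formula is true (entries `(false, l)`). -/
abbrev EvalTable := List (Bool × List ℕ)

/-- The condition for the entry `q` to be in the table of the number `ts.length`, when `ts` lists
the tables of all smaller numbers. -/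
def EvalStep (p : EvalData) (ts : List EvalTable) (q : Bool × List ℕ) : Prop :=
  (q.1 = true ∧ AtomWF p.2.1 q.2 ts.length) ∨
  (q.1 = false ∧ AtomTrue p.2.2 p.2.1 q.2 ts.length) ∨
  (ts.length.unpair.1 = 3 ∧ q.1 = true ∧ q ∈ ts.getD ts.length.unpair.2.unpair.1 [] ∧
    q ∈ ts.getD ts.length.unpair.2.unpair.2 []) ∨
  (ts.length.unpair.1 = 3 ∧ q.1 = false ∧ (q ∈ ts.getD ts.length.unpair.2.unpair.1 [] →
    q ∈ ts.getD ts.length.unpair.2.unpair.2 [])) ∨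
  (ts.length.unpair.1 = 4 ∧ ∀ x ∈ List.range (quantBound p.1 p.2.1),
    (q.1, q.2 ++ [x]) ∈ ts.getD ts.length.unpair.2 [])

open Classical in
/-- The table of the number `ts.length`, when `ts` lists the tables of all smaller numbers. -/
noncomputable def evalNext (p : EvalData) (ts : List EvalTable) : EvalTable :=
  ((assignments (quantBound p.1 p.2.1) p.1).flatMap fun l => [(true, l), (false, l)]).filter
    fun q => EvalStep p ts q

/-- The table of the number `c`. Its assignments have length at most `p.1`, so that quantifiers are
only evaluated up to that depth, and entries less than the bound for the quantifiers. -/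
noncomputable def evalTable (p : EvalData) (c : ℕ) : EvalTable :=
  evalNext p ((List.range c).attach.map fun i => evalTable p i.1)
termination_by c
decreasing_by exact List.mem_range.1 i.2

theorem evalTable_eq (p : EvalData) (c : ℕ) :
    evalTable p c = evalNext p ((List.range c).map (evalTable p)) := by
  rw [evalTable]
  simp

theorem mem_assignments {b k : ℕ} {l : List ℕ} :
    l ∈ assignments b k ↔ l.length ≤ k ∧ ∀ x ∈ l, x < b := by
  induction k generalizing l with
  | zero =>
    change l ∈ [ [] ] ↔ _
    simp only [List.mem_singleton, nonpos_iff_eq_zero, List.length_eq_zero_iff]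
    exact ⟨fun h => ⟨h, by simp [h]⟩, And.left⟩
  | succ k ih =>
    change l ∈ [] :: (assignments b k).flatMap _ ↔ _
    cases l with
    | nil => simp
    | cons y l =>
      simp only [List.mem_cons, List.mem_flatMap, List.mem_map, List.mem_range, ih]
      constructor
      · rintro (h | ⟨l', ⟨h1, h2⟩, y', hy, h⟩)
        · exact absurd h (by simp)
        · obtain ⟨rfl, rfl⟩ := List.cons_eq_cons.1 h
          exact ⟨by simpa using h1, fun x hx => hx.elim (fun e => e ▸ hy) (h2 x)⟩
      · rintro ⟨h1, h2⟩
        exact Or.inr ⟨l, ⟨by simpa using h1, fun x hx => h2 x (Or.inr hx)⟩, y, h2 y (Or.inl rfl),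
          rfl⟩

theorem mem_evalTable {p : EvalData} {c : ℕ} {m : Bool} {l : List ℕ} :
    (m, l) ∈ evalTable p c ↔
      (l.length ≤ p.1 ∧ ∀ x ∈ l, x < quantBound p.1 p.2.1) ∧
        EvalStep p ((List.range c).map (evalTable p)) (m, l) := by
  rw [evalTable_eq, evalNext, List.mem_filter, List.mem_flatMap]
  refine and_congr ⟨?_, fun h => ⟨l, mem_assignments.2 h, by cases m <;> simp⟩⟩ (by simp)
  rintro ⟨l', h, h'⟩
  obtain rfl : l = l' := by
    simp only [List.mem_cons, Prod.mk.injEq, List.not_mem_nil, or_false] at h'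
    tauto
  exact mem_assignments.1 h

theorem getD_map_range_of_lt {σ : Type} (f : ℕ → σ) (d : σ) {i c : ℕ} (h : i < c) :
    ((List.range c).map f).getD i d = f i := by
  simp [List.getD, h]

/-! ### The evaluation is primitive recursive -/

section Primrec

variable {α : Type} [Primcodable α]

theorem primrec_unpair_fst {f : α → ℕ} (hf : Primrec f) : Primrec fun a => (f a).unpair.1 :=
  Primrec.fst.comp (Primrec.unpair.comp hf)

theorem primrec_unpair_snd {f : α → ℕ} (hf : Primrec f) : Primrec fun a => (f a).unpair.2 :=
  Primrec.snd.comp (Primrec.unpair.comp hf)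

theorem primrec_pair {f g : α → ℕ} (hf : Primrec f) (hg : Primrec g) :
    Primrec fun a => Nat.pair (f a) (g a) :=
  Primrec₂.natPair.comp hf hg

theorem primrec_varValue {w l : α → List ℕ} {u : α → ℕ} (hw : Primrec w) (hl : Primrec l)
    (hu : Primrec u) : Primrec fun a => varValue (w a) (l a) (u a) := by
  have h : Primrec fun a => u a / 2 := Primrec.nat_div.comp hu (Primrec.const 2)
  exact Primrec.ite (Primrec.eq.comp (Primrec.nat_mod.comp hu (Primrec.const 2)) (Primrec.const 0))
    (Primrec.list_getElem?.comp hw h) (Primrec.list_getElem?.comp hl h)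

theorem primrecPred_eq_const {σ : Type} [Primcodable σ] [DecidableEq σ] {f : α → σ}
    (hf : Primrec f) (s : σ) : PrimrecPred fun a => f a = s :=
  Primrec.eq.comp hf (Primrec.const s)

theorem primrecPred_haltsIn {σ : α → List Bool} {e s : α → ℕ} (hσ : Primrec σ) (he : Primrec e)
    (hs : Primrec s) : PrimrecPred fun a => HaltsIn (σ a) (e a) (s a) := by
  have hR : PrimrecRel fun (t : ℕ) (y : List Bool × ℕ × ℕ) => (Nat.Partrec.Code.evaln y.2.2
      (Denumerable.ofNat Nat.Partrec.Code y.2.1)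
      (Nat.pair y.2.1 (Encodable.encode (y.1.take t)))).isSome = true := by
    have h1 : Primrec fun z : ℕ × List Bool × ℕ × ℕ => z.2.1 := Primrec.fst.comp Primrec.snd
    have h2 : Primrec fun z : ℕ × List Bool × ℕ × ℕ => z.2.2.1 :=
      Primrec.fst.comp (Primrec.snd.comp Primrec.snd)
    have h3 : Primrec fun z : ℕ × List Bool × ℕ × ℕ => z.2.2.2 :=
      Primrec.snd.comp (Primrec.snd.comp Primrec.snd)
    exact primrecPred_eq_const (Primrec.option_isSome.comp (Nat.Partrec.Code.primrec_evaln.comp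
      ((h3.pair ((Primrec.ofNat _).comp h2)).pair (primrec_pair h2
        (Primrec.encode.comp (Primrec.list_take.comp Primrec.fst h1)))))) true
  exact (hR.exists_mem_list.comp (Primrec.list_range.comp (Primrec.succ.comp hs))
    (hσ.pair (he.pair hs))).of_eq fun a => by simp [HaltsIn]

theorem primrecPred_relHolds {σ : α → List Bool} {r x : α → ℕ} (hσ : Primrec σ) (hr : Primrec r)
    (hx : Primrec x) : PrimrecPred fun a => RelHolds (σ a) (r a) (x a) := by
  have h2 : Primrec fun a => r a / 2 := Primrec.nat_div.comp hr (Primrec.const 2)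
  have hm : Primrec fun a => r a % 2 := Primrec.nat_mod.comp hr (Primrec.const 2)
  exact ((primrecPred_eq_const hm 0).and
      (Primrec.eq.comp (Primrec.nat_div.comp hx (Primrec.const 2)) h2)).or
    ((primrecPred_eq_const hm 1).and ((Primrec.eq.comp hx (Primrec.succ.comp
      (Primrec.nat_mul.comp (Primrec.const 2) (primrec_unpair_fst h2)))).and
      (primrecPred_haltsIn hσ (primrec_unpair_fst h2) (primrec_unpair_snd h2))))

variable {w l : α → List ℕ} {c : α → ℕ}

theorem primrecPred_atomWF (hw : Primrec w) (hl : Primrec l) (hc : Primrec c) :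
    PrimrecPred fun a => AtomWF (w a) (l a) (c a) := by
  have h2 := primrec_unpair_snd hc
  have h1 := primrec_unpair_snd (primrec_unpair_fst h2)
  have h3 := primrec_unpair_snd (primrec_unpair_snd h2)
  have h4 := primrec_unpair_snd (primrec_unpair_fst (Primrec.pred.comp (primrec_unpair_snd h2)))
  exact (primrecPred_eq_const hc 0).or
    (((Primrec.eq.comp hc (primrec_pair (Primrec.const 1)
        (primrec_pair (primrec_pair (Primrec.const 0) h1) (primrec_pair (Primrec.const 0) h3)))).and
      ((primrecPred_eq_const (Primrec.option_isSome.comp (primrec_varValue hw hl h1)) true).and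
        (primrecPred_eq_const (Primrec.option_isSome.comp (primrec_varValue hw hl h3)) true))).or
    ((Primrec.eq.comp hc (primrec_pair (Primrec.const 2)
        (primrec_pair (primrec_pair (Primrec.const 1) h1) (Primrec.succ.comp
          (primrec_pair (primrec_pair (Primrec.const 0) h4) (Primrec.const 0)))))).and
      (primrecPred_eq_const (Primrec.option_isSome.comp (primrec_varValue hw hl h4)) true)))

theorem primrecPred_atomTrue {σ : α → List Bool} (hσ : Primrec σ) (hw : Primrec w)
    (hl : Primrec l) (hc : Primrec c) :
    PrimrecPred fun a => AtomTrue (σ a) (w a) (l a) (c a) := by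
  have h0 := primrec_unpair_fst hc
  have h2 := primrec_unpair_snd hc
  have h1 := primrec_unpair_snd (primrec_unpair_fst h2)
  have h3 := primrec_unpair_snd (primrec_unpair_snd h2)
  have h4 := primrec_unpair_snd (primrec_unpair_fst (Primrec.pred.comp (primrec_unpair_snd h2)))
  exact ((primrecPred_eq_const h0 1).and
      (Primrec.eq.comp (primrec_varValue hw hl h1) (primrec_varValue hw hl h3))).or
    ((primrecPred_eq_const h0 2).and (primrecPred_relHolds hσ h1
      (Primrec.option_getD.comp (primrec_varValue hw hl h4) (Primrec.const 0))))

theorem primrec_quantBound {w : α → List ℕ} {c : α → ℕ} (hc : Primrec c) (hw : Primrec w) :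
    Primrec fun a => quantBound (c a) (w a) :=
  Primrec.nat_add.comp (Primrec.nat_add.comp (Primrec.nat_mul.comp (Primrec.const 3) hc)
    (Primrec.nat_mul.comp (Primrec.const 2) (Primrec.encode.comp hw))) (Primrec.const 3)

theorem primrec_assignments : Primrec₂ assignments := by
  refine Primrec.nat_rec' (f := fun p : ℕ × ℕ => p.2) (g := fun _ => [ [] ])
    (h := fun p r => [] :: r.2.flatMap fun l => (List.range p.1).map fun x => x :: l)
    Primrec.snd (Primrec.const _) (Primrec.list_cons.comp (Primrec.const _)
      (Primrec.list_flatMap (Primrec.snd.comp Primrec.snd) (Primrec.list_map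
        (Primrec.list_range.comp (Primrec.fst.comp (Primrec.fst.comp Primrec.fst)))
        (Primrec.list_cons.comp Primrec.snd (Primrec.snd.comp Primrec.fst)))))

theorem primrecPred_mem {β : Type} [Primcodable β] [DecidableEq β] {b : α → β} {L : α → List β}
    (hb : Primrec b) (hL : Primrec L) : PrimrecPred fun a => b a ∈ L a :=
  ((Primrec.eq (α := β)).exists_mem_list.comp hL hb).of_eq fun a => by simp

theorem primrecRel_evalStep :
    PrimrecRel fun (q : Bool × List ℕ) (y : EvalData × List EvalTable) => EvalStep y.1 y.2 q := by
  have hq : Primrec fun z : (Bool × List ℕ) × EvalData × List EvalTable => z.1 := Primrec.fst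
  have hm := Primrec.fst.comp hq
  have hl := Primrec.snd.comp hq
  have hp : Primrec fun z : (Bool × List ℕ) × EvalData × List EvalTable => z.2.1 :=
    Primrec.fst.comp Primrec.snd
  have hw := Primrec.fst.comp (Primrec.snd.comp hp)
  have hσ := Primrec.snd.comp (Primrec.snd.comp hp)
  have hts : Primrec fun z : (Bool × List ℕ) × EvalData × List EvalTable => z.2.2 :=
    Primrec.snd.comp Primrec.snd
  have hc := Primrec.list_length.comp hts
  have hc1 := primrec_unpair_fst hc
  have hc2 := primrec_unpair_snd hc
  have hget : ∀ {f : (Bool × List ℕ) × EvalData × List EvalTable → ℕ}, Primrec f →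
      Primrec fun z : (Bool × List ℕ) × EvalData × List EvalTable => z.2.2.getD (f z) [] :=
    fun hf => (Primrec.list_getD []).comp hts hf
  have ha := primrecPred_mem hq (hget (primrec_unpair_fst hc2))
  have hb := primrecPred_mem hq (hget (primrec_unpair_snd hc2))
  have hall : PrimrecRel fun (x : ℕ) (z : (Bool × List ℕ) × EvalData × List EvalTable) =>
      (z.1.1, z.1.2 ++ [x]) ∈ z.2.2.getD z.2.2.length.unpair.2 [] :=
    primrecPred_mem ((hm.comp Primrec.snd).pair (Primrec.list_append.comp (hl.comp Primrec.snd)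
      (Primrec.list_cons.comp Primrec.fst (Primrec.const [])))) ((hget hc2).comp Primrec.snd)
  refine ((primrecPred_eq_const hm true).and (primrecPred_atomWF hw hl hc)).or
    (((primrecPred_eq_const hm false).and (primrecPred_atomTrue hσ hw hl hc)).or
    (((primrecPred_eq_const hc1 3).and ((primrecPred_eq_const hm true).and (ha.and hb))).or
    (((primrecPred_eq_const hc1 3).and ((primrecPred_eq_const hm false).and
      ((ha.not.or hb).of_eq fun z => imp_iff_not_or.symm))).or
    ((primrecPred_eq_const hc1 4).and (hall.forall_mem_list.comp (Primrec.list_range.comp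
      (primrec_quantBound (Primrec.fst.comp hp) hw)) Primrec.id)))))

theorem primrec_evalNext : Primrec₂ evalNext := by
  classical
  have h : Primrec fun y : EvalData × List EvalTable =>
      (assignments (quantBound y.1.1 y.1.2.1) y.1.1).flatMap fun l => [(true, l), (false, l)] :=
    Primrec.list_flatMap (primrec_assignments.comp (primrec_quantBound
        (Primrec.fst.comp Primrec.fst) (Primrec.fst.comp (Primrec.snd.comp Primrec.fst)))
        (Primrec.fst.comp Primrec.fst))
      (Primrec.list_cons.comp ((Primrec.const true).pair Primrec.snd)
        (Primrec.list_cons.comp ((Primrec.const false).pair Primrec.snd) (Primrec.const [])))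
  exact ((PrimrecRel.listFilter primrecRel_evalStep).comp h Primrec.id).of_eq fun y => by
    simp only [evalNext, id]

theorem primrec_evalTable : Primrec₂ evalTable :=
  Primrec.nat_strong_rec evalTable (g := fun p ts => some (evalNext p ts))
    (Primrec.option_some.comp primrec_evalNext) fun p c => congrArg some (evalTable_eq p c).symm

end Primrec

/-! ### The evaluation is correct -/

theorem haltsIn_initSeg {X : Set ℕ} {e s N : ℕ} (h : s ≤ N) :
    HaltsIn (initSeg X N) e s ↔ HaltsBy X e e s := by
  simp only [HaltsIn, HaltsBy, Nat.lt_succ_iff]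
  refine exists_congr fun t => and_congr_right fun ht => ?_
  rw [take_initSeg X (ht.trans h)]

theorem haltModel.mk_inj {X : Set ℕ} {m n : ℕ} :
    haltModel.mk X m = haltModel.mk X n ↔ m = n :=
  ⟨congrArg Subtype.val, congrArg _⟩

theorem relHolds_initSeg {X : Set ℕ} {r : HaltRel 1} {N : ℕ} (h : haltRelCode 1 r ≤ N)
    (x : (haltModel X).dom) : RelHolds (initSeg X N) (haltRelCode 1 r) x ↔
      Structure.RelMap (L := haltLang) r ![x] := by
  cases r with
  | block i =>
    change _ ↔ (x : ℕ) / 2 = i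
    simp [RelHolds, haltRelCode]
  | stage i s =>
    have h' : 2 * Nat.pair i s + 1 ≤ N := h
    change _ ↔ (x : ℕ) = 2 * i + 1 ∧ HaltsBy X i i s
    have h1 : (2 * Nat.pair i s + 1) % 2 = 1 := by omega
    have h2 : (2 * Nat.pair i s + 1) / 2 = Nat.pair i s := by omega
    have h3 : s ≤ N := (Nat.right_le_pair i s).trans (by omega)
    simp [RelHolds, haltRelCode, h1, h2, haltsIn_initSeg h3]

section

variable {p : EvalData} {m : Bool} {l : List ℕ}

theorem mem_evalTable_atom {c : ℕ} (hc : c.unpair.1 < 3)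
    (hl : l.length ≤ p.1 ∧ ∀ x ∈ l, x < quantBound p.1 p.2.1) :
    ((true, l) ∈ evalTable p c ↔ AtomWF p.2.1 l c) ∧
      ((false, l) ∈ evalTable p c ↔ AtomTrue p.2.2 p.2.1 l c) := by
  have h3 : c.unpair.1 ≠ 3 := by omega
  have h4 : c.unpair.1 ≠ 4 := by omega
  constructor <;> simp [mem_evalTable, EvalStep, hl.1, h3, h4] <;> exact fun _ => hl.2

theorem not_atomWF {w : List ℕ} {c : ℕ} (hc : 3 ≤ c.unpair.1) : ¬ AtomWF w l c := by
  rintro (h | ⟨h, -⟩ | ⟨h, -⟩)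
  · rw [h] at hc; simp at hc
  · rw [h, Nat.unpair_pair] at hc; simp at hc
  · rw [h, Nat.unpair_pair] at hc; simp at hc

theorem not_atomTrue {σ : List Bool} {w : List ℕ} {c : ℕ} (hc : 3 ≤ c.unpair.1) :
    ¬ AtomTrue σ w l c := by
  rintro (⟨h, -⟩ | ⟨h, -⟩) <;> omega

theorem lt_pair_of_pos {k n : ℕ} (hk : 0 < k) : n < Nat.pair k n := by
  have := Nat.add_le_pair k n
  omega

theorem mem_evalTable_imp {a b : ℕ}
    (hl : l.length ≤ p.1 ∧ ∀ x ∈ l, x < quantBound p.1 p.2.1) :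
    ((true, l) ∈ evalTable p (Nat.pair 3 (Nat.pair a b)) ↔
        (true, l) ∈ evalTable p a ∧ (true, l) ∈ evalTable p b) ∧
      ((false, l) ∈ evalTable p (Nat.pair 3 (Nat.pair a b)) ↔
        ((false, l) ∈ evalTable p a → (false, l) ∈ evalTable p b)) := by
  have hab : Nat.pair a b < Nat.pair 3 (Nat.pair a b) := lt_pair_of_pos (by omega)
  have ha := (Nat.left_le_pair a b).trans_lt hab
  have hb := (Nat.right_le_pair a b).trans_lt hab
  constructor <;> refine mem_evalTable.trans ?_ <;> rw [and_iff_right hl] <;>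
  simp only [EvalStep, List.length_map, List.length_range, Nat.unpair_pair,
    getD_map_range_of_lt _ _ ha, getD_map_range_of_lt _ _ hb,
    not_atomWF (c := Nat.pair 3 (Nat.pair a b)) (by simp),
    not_atomTrue (c := Nat.pair 3 (Nat.pair a b)) (by simp)] <;> simp

theorem mem_evalTable_all {a : ℕ}
    (hl : l.length ≤ p.1 ∧ ∀ x ∈ l, x < quantBound p.1 p.2.1) :
    (m, l) ∈ evalTable p (Nat.pair 4 a) ↔
      ∀ x < quantBound p.1 p.2.1, (m, l ++ [x]) ∈ evalTable p a := by
  have ha : a < Nat.pair 4 a := lt_pair_of_pos (by omega)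
  rw [mem_evalTable, and_iff_right hl]
  simp only [EvalStep, List.length_map, List.length_range, Nat.unpair_pair,
    getD_map_range_of_lt _ _ ha,
    not_atomWF (c := Nat.pair 4 a) (by simp), not_atomTrue (c := Nat.pair 4 a) (by simp)]
  simp

theorem concat_bounds {B K x : ℕ} (hl : ∀ y ∈ l, y < B) (hK : l.length + 1 ≤ K) (hx : x < B) :
    (l ++ [x]).length ≤ K ∧ ∀ y ∈ l ++ [x], y < B := by
  refine ⟨by simpa using hK, fun y hy => ?_⟩
  rcases List.mem_append.1 hy with h | h
  · exact hl y h
  · rw [List.mem_singleton.1 h]; exact hx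

end

theorem lt_encode_of_mem {w : List ℕ} {x : ℕ} (hx : x ∈ w) : x < Encodable.encode w := by
  induction w with
  | nil => simp at hx
  | cons y w ih =>
    rw [Encodable.encode_list_cons]
    rcases List.mem_cons.1 hx with rfl | h
    · exact Nat.lt_succ_of_le (Nat.left_le_pair _ _)
    · exact (ih h).trans (Nat.lt_succ_of_le (Nat.right_le_pair _ _))

/-- There is room below the bound for the quantifiers for an element which is not a parameter and
lies in a block that is not mentioned. -/
theorem exists_fresh {c : ℕ} {w l : List ℕ} (hl : l.length ≤ c) :
    ∃ x < quantBound c w, 2 * (c + 1) ≤ x ∧ x ∉ w ∧ x ∉ l := by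
  classical
  have hw := Encodable.length_le_encode w
  have hcard : (w ++ l).toFinset.card < (Finset.Ico (2 * (c + 1)) (quantBound c w)).card := by
    refine (List.toFinset_card_le _).trans_lt ?_
    rw [Nat.card_Ico, List.length_append, quantBound]
    omega
  obtain ⟨x, hx, hx'⟩ := Finset.exists_mem_notMem_of_card_lt_card hcard
  rw [Finset.mem_Ico] at hx
  rw [List.mem_toFinset, List.mem_append, not_or] at hx'
  exact ⟨x, hx.2, hx.1, hx'⟩

theorem varValue_varCode {w l : List ℕ} {α : Type} {v : α → ℕ} (hv : ∀ a, v a < w.length)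
    {n : ℕ} (hl : l.length = n) (u : α ⊕ Fin n) :
    varValue w l (varCode v u) =
      some (Sum.elim (fun a => w.getD (v a) 0) (fun i : Fin n => l.getD i 0) u) := by
  rcases u with a | i
  · simp [varValue, varCode, hv]
  · have h1 : (2 * (i : ℕ) + 1) % 2 = 1 := by omega
    have h2 : (2 * (i : ℕ) + 1) / 2 = i := by omega
    have h3 : (i : ℕ) < l.length := by omega
    simp [varValue, varCode, h1, h2, h3]

/-- A number to which `varValue` assigns a value is the number of a variable in scope. -/
theorem exists_varCode_eq {w l : List ℕ} {α : Type} {v : α → ℕ}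
    (hv : ∀ j, j < w.length → ∃ a, v a = j) {n : ℕ} (hl : l.length = n) {k : ℕ}
    (hk : (varValue w l k).isSome = true) : ∃ u : α ⊕ Fin n, varCode v u = k := by
  unfold varValue at hk
  split_ifs at hk with h
  · obtain ⟨a, ha⟩ := hv (k / 2) (by simpa using hk)
    exact ⟨Sum.inl a, by simp only [varCode, Sum.elim_inl, ha]; omega⟩
  · have : k / 2 < n := by simpa [hl] using hk
    exact ⟨Sum.inr ⟨k / 2, this⟩, by simp only [varCode, Sum.elim_inr]; omega⟩

theorem bdCode_rel {α : Type} (v : α → ℕ) {n : ℕ} (r : HaltRel 1) (u : α ⊕ Fin n)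
    (ts : Fin 1 → haltLang.Term (α ⊕ Fin n)) (hu : ts 0 = .var u) :
    bdCode v (BoundedFormula.rel (L := haltLang) (show haltLang.Relations 1 from r) ts) =
      Nat.pair 2 (Nat.pair (Nat.pair 1 (haltRelCode 1 r))
        (Nat.pair (Nat.pair 0 (varCode v u)) 0 + 1)) := by
  have : List.ofFn (fun i => termCode (varCode v) (ts i)) = [Nat.pair 0 (varCode v u)] := by
    rw [List.ofFn_succ, hu]
    simp [termCode]
  change Nat.pair 2 (Nat.pair (Nat.pair 1 (haltRelCode 1 r)) (Encodable.encode (List.ofFn _))) = _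
  rw [this]
  rfl

theorem haltRelCode_surjective : Function.Surjective (haltRelCode 1) := by
  intro k
  obtain h | h : k = 2 * (k / 2) ∨ k = 2 * (k / 2) + 1 := by omega
  · exact ⟨.block (k / 2), by rw [haltRelCode]; exact h.symm⟩
  · exact ⟨.stage (k / 2).unpair.1 (k / 2).unpair.2, by
      rw [haltRelCode, Nat.pair_unpair]; exact h.symm⟩

section

variable {X : Set ℕ} {c N : ℕ} {w : List ℕ} {α : Type} {v : α → ℕ}

/-- The entries `(true, l)` belong to Gödel numbers of formulas. -/
theorem exists_bdCode_eq_of_mem_evalTable {p : EvalData}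
    (hv : ∀ j, j < p.2.1.length → ∃ a, v a = j) {d : ℕ} :
    ∀ {n : ℕ} {l : List ℕ}, l.length = n → (true, l) ∈ evalTable p d →
      ∃ φ : haltLang.BoundedFormula α n, bdCode v φ = d := by
  induction d using Nat.strong_induction_on with
  | _ d ih =>
  intro n l hl h
  have hb := (mem_evalTable.1 h).1
  by_cases h3 : d.unpair.1 < 3
  · rcases ((mem_evalTable_atom h3 hb).1.1 h) with h | ⟨h, h1, h2⟩ | ⟨h, h1⟩
    · exact ⟨.falsum, by rw [h]; rfl⟩
    · obtain ⟨u₁, hu₁⟩ := exists_varCode_eq hv hl h1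
      obtain ⟨u₂, hu₂⟩ := exists_varCode_eq hv hl h2
      refine ⟨.equal (.var u₁) (.var u₂), ?_⟩
      rw [h, ← hu₁, ← hu₂]
      rfl
    · obtain ⟨u, hu⟩ := exists_varCode_eq hv hl h1
      obtain ⟨r, hr⟩ := haltRelCode_surjective d.unpair.2.unpair.1.unpair.2
      refine ⟨.rel (L := haltLang) (show haltLang.Relations 1 from r) fun _ => .var u, ?_⟩
      rw [bdCode_rel v r u _ rfl, h, hu, hr]
  · obtain ⟨k, e, rfl⟩ : ∃ k e, d = Nat.pair k e := ⟨_, _, (Nat.pair_unpair d).symm⟩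
    rw [Nat.unpair_pair] at h3
    have hlt : e < Nat.pair k e := lt_pair_of_pos (by simp at h3; omega)
    by_cases hk3 : k = 3
    · subst hk3
      obtain ⟨a, b, rfl⟩ : ∃ a b, e = Nat.pair a b := ⟨_, _, (Nat.pair_unpair e).symm⟩
      rw [(mem_evalTable_imp hb).1] at h
      obtain ⟨φ, hφ⟩ := ih a ((Nat.left_le_pair a b).trans_lt hlt) hl h.1
      obtain ⟨ψ, hψ⟩ := ih b ((Nat.right_le_pair a b).trans_lt hlt) hl h.2
      refine ⟨.imp φ ψ, ?_⟩
      rw [bdCode, hφ, hψ]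
    · by_cases hk4 : k = 4
      · subst hk4
        rw [mem_evalTable_all hb] at h
        have := h 0 (by rw [quantBound]; omega)
        obtain ⟨φ, hφ⟩ := ih e hlt (n := n + 1) (by simp [hl]) this
        refine ⟨.all φ, ?_⟩
        rw [bdCode, hφ]
      · exfalso
        have h := (mem_evalTable.1 h).2
        simp only [not_lt] at h3
        rcases h with ⟨-, h⟩ | ⟨h, -⟩ | ⟨h, -⟩ | ⟨h, -⟩ | ⟨h, -⟩
        · exact not_atomWF (by simpa using h3) h
        · simp at h
        · simp [hk3] at h
        · simp [hk3] at h
        · simp [hk4] at h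

/-- Formulas have all the entries `(true, l)` within the bounds. -/
theorem mem_evalTable_true {p : EvalData} (hv : ∀ a, v a < p.2.1.length) {n : ℕ}
    (φ : haltLang.BoundedFormula α n) {l : List ℕ} (hl : l.length = n)
    (hlt : ∀ x ∈ l, x < quantBound p.1 p.2.1) (hc : l.length + bdCode v φ ≤ p.1) :
    (true, l) ∈ evalTable p (bdCode v φ) := by
  induction φ generalizing l with
  | falsum => exact (mem_evalTable_atom (by simp [bdCode]) ⟨by omega, hlt⟩).1.2 (Or.inl rfl)
  | equal t₁ t₂ =>
    obtain ⟨u₁, rfl⟩ := haltLang_term_eq_var t₁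
    obtain ⟨u₂, rfl⟩ := haltLang_term_eq_var t₂
    refine (mem_evalTable_atom (by simp [bdCode]) ⟨by omega, hlt⟩).1.2 (Or.inr (Or.inl ?_))
    simp [bdCode, termCode, varValue_varCode hv hl]
  | @rel n k R ts =>
    obtain rfl : k = 1 := by cases R <;> rfl
    obtain ⟨u, hu⟩ := haltLang_term_eq_var (ts 0)
    rw [bdCode_rel v R u ts hu] at hc ⊢
    refine (mem_evalTable_atom (by simp) ⟨by omega, hlt⟩).1.2 (Or.inr (Or.inr ?_))
    simp [varValue_varCode hv hl]
  | imp φ ψ ih₁ ih₂ =>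
    rw [bdCode] at hc ⊢
    have h1 := Nat.right_le_pair 3 (Nat.pair (bdCode v φ) (bdCode v ψ))
    have h2 := Nat.left_le_pair (bdCode v φ) (bdCode v ψ)
    have h3 := Nat.right_le_pair (bdCode v φ) (bdCode v ψ)
    exact (mem_evalTable_imp ⟨by omega, hlt⟩).1.2
      ⟨ih₁ hl hlt (by omega), ih₂ hl hlt (by omega)⟩
  | all φ ih =>
    rw [bdCode] at hc ⊢
    have h1 := Nat.add_le_pair 4 (bdCode v φ)
    refine (mem_evalTable_all ⟨by omega, hlt⟩).2 fun x hx => ?_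
    exact ih (by simp [hl]) (concat_bounds hlt (K := p.1) (by omega) hx).2
      (by rw [List.length_append, List.length_singleton]; omega)

/-- Truth in the standard model is computed correctly. The point is the bound on the quantifiers:
an element beyond it can be exchanged with one that is below it, is not a parameter, and lies in no
block mentioned in the formula. -/
theorem mem_evalTable_false_iff (hN : c ≤ N) (hv : ∀ a, v a < w.length) {n : ℕ}
    (φ : haltLang.BoundedFormula α n) {l : List ℕ} (hl : l.length = n)
    (hlt : ∀ x ∈ l, x < quantBound c w) (hc : l.length + bdCode v φ ≤ c) :
    (false, l) ∈ evalTable (c, w, initSeg X N) (bdCode v φ) ↔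
      φ.Realize (fun a => haltModel.mk X (w.getD (v a) 0))
        (fun i => haltModel.mk X (l.getD i 0)) := by
  have hterm : ∀ {n : ℕ} (l : List ℕ) (u : α ⊕ Fin n),
      Sum.elim (fun a => haltModel.mk X (w.getD (v a) 0))
        (fun i : Fin n => haltModel.mk X (l.getD i 0)) u
        = haltModel.mk X (Sum.elim (fun a => w.getD (v a) 0) (fun i : Fin n => l.getD i 0) u) := by
    rintro n l (a | i) <;> rfl
  induction φ generalizing l with
  | falsum =>
    rw [(mem_evalTable_atom (by simp [bdCode]) ⟨by dsimp only; omega, hlt⟩).2]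
    refine iff_of_false ?_ id
    rintro (⟨h, -⟩ | ⟨h, -⟩) <;> simp [bdCode] at h
  | equal t₁ t₂ =>
    obtain ⟨u₁, rfl⟩ := haltLang_term_eq_var t₁
    obtain ⟨u₂, rfl⟩ := haltLang_term_eq_var t₂
    rw [(mem_evalTable_atom (by simp [bdCode]) ⟨by dsimp only; omega, hlt⟩).2]
    change _ ↔ Sum.elim _ _ u₁ = Sum.elim _ _ u₂
    rw [hterm, hterm, haltModel.mk_inj]
    simp [AtomTrue, bdCode, termCode, varValue_varCode hv hl]
  | @rel n k R ts =>
    obtain rfl : k = 1 := by cases R <;> rfl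
    obtain ⟨u, hu⟩ := haltLang_term_eq_var (ts 0)
    rw [bdCode_rel v R u ts hu] at hc ⊢
    rw [(mem_evalTable_atom (by simp) ⟨by dsimp only; omega, hlt⟩).2]
    have hR : haltRelCode 1 R ≤ N := by
      refine le_trans ?_ hN
      refine le_trans ?_ ((Nat.le_add_left _ _).trans hc)
      exact (Nat.right_le_pair _ _).trans ((Nat.left_le_pair _ _).trans (Nat.right_le_pair 2 _))
    have key : (fun i => (ts i).realize (Sum.elim (fun a => haltModel.mk X (w.getD (v a) 0))
        (fun i : Fin n => haltModel.mk X (l.getD i 0)))) =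
        ![haltModel.mk X (Sum.elim (fun a => w.getD (v a) 0) (fun i : Fin n => l.getD i 0) u)] := by
      funext i
      rw [Subsingleton.elim i 0, hu, ← hterm]
      rfl
    change _ ↔ Structure.RelMap R (fun i => (ts i).realize _)
    rw [key]
    refine Iff.trans ?_ (relHolds_initSeg hR _)
    simp [AtomTrue, varValue_varCode hv hl, haltModel.mk]
  | imp φ ψ ih₁ ih₂ =>
    rw [bdCode] at hc ⊢
    have h1 := Nat.right_le_pair 3 (Nat.pair (bdCode v φ) (bdCode v ψ))
    have h2 := Nat.left_le_pair (bdCode v φ) (bdCode v ψ)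
    have h3 := Nat.right_le_pair (bdCode v φ) (bdCode v ψ)
    rw [(mem_evalTable_imp ⟨by dsimp only; omega, hlt⟩).2]
    exact imp_congr (ih₁ hl hlt (by omega)) (ih₂ hl hlt (by omega))
  | @all n φ ih =>
    rw [bdCode] at hc ⊢
    have h1 := Nat.add_le_pair 4 (bdCode v φ)
    rw [mem_evalTable_all ⟨by dsimp only; omega, hlt⟩, BoundedFormula.realize_all]
    have hsnoc : ∀ x : ℕ, (fun i : Fin (n + 1) => haltModel.mk X ((l ++ [x]).getD i 0)) =
        Fin.snoc (fun i : Fin n => haltModel.mk X (l.getD i 0)) (haltModel.mk X x) := by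
      intro x
      funext i
      refine Fin.lastCases ?_ (fun i => ?_) i
      · simp [← hl]
      · have : (i : ℕ) < l.length := by omega
        rw [Fin.snoc_castSucc]
        exact congrArg (haltModel.mk X) (List.getD_append _ _ _ _ this)
    have hstep : ∀ x < quantBound c w,
        ((false, l ++ [x]) ∈ evalTable (c, w, initSeg X N) (bdCode v φ) ↔
          φ.Realize (fun a => haltModel.mk X (w.getD (v a) 0))
            (Fin.snoc (fun i : Fin n => haltModel.mk X (l.getD i 0)) (haltModel.mk X x))) := by
      intro x hx
      rw [← hsnoc]
      exact ih (by simp [hl]) (concat_bounds hlt (K := c) (by omega) hx).2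
        (by rw [List.length_append, List.length_singleton]; omega)
    refine ⟨fun h y => ?_, fun h x hx => (hstep x hx).2 (h _)⟩
    obtain ⟨y, hy⟩ := y
    change φ.Realize _ (Fin.snoc _ (haltModel.mk X y))
    by_cases hyB : y < quantBound c w
    · exact (hstep y hyB).1 (h y hyB)
    obtain ⟨x, hxB, hxc, hxw, hxl⟩ := exists_fresh (c := c) (w := w) (l := l) (by omega)
    have hBc : 2 * (c + 1) ≤ y := by rw [quantBound] at hyB; omega
    have hyw : y ∉ w := fun hc => by
      have := lt_encode_of_mem hc
      rw [quantBound] at hyB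
      omega
    have hyl : y ∉ l := fun hc => hyB (hlt y hc)
    have hne : ∀ {z : ℕ} {L : List ℕ} {j : ℕ}, j < L.length → z ∉ L →
        haltModel.mk X (L.getD j 0) ≠ haltModel.mk X z := by
      intro z L j hj hz he
      have : L.getD j 0 = z := congrArg Subtype.val he
      rw [List.getD_eq_getElem _ _ hj] at this
      exact hz (this ▸ List.getElem_mem hj)
    refine (realize_snoc_congr (c := c) (fun r hr => ?_) v φ (by omega) _ _
      (fun a => ⟨hne (hv a) hxw, hne (hv a) hyw⟩)
      (fun i => ⟨hne (by omega) hxl, hne (by omega) hyl⟩)).1 ((hstep x hxB).1 (h x hxB))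
    have hout : ∀ (z : ℕ), 2 * (c + 1) ≤ z →
        ¬ Structure.RelMap (L := haltLang) r ![haltModel.mk X z] := by
      intro z hz hrz
      cases r with
      | block i =>
        have h1 : z / 2 = i := hrz
        have h2 : 2 * i ≤ c := hr
        omega
      | stage i s =>
        have h1 : z = 2 * i + 1 := hrz.1
        have h2 : 2 * Nat.pair i s + 1 ≤ c := hr
        have h3 := Nat.left_le_pair i s
        omega
    exact iff_of_false (hout x hxc) (hout y hBc)

/-- The table of `c` shows whether `c` is the Gödel number of a formula, in free variables numbered
by the positions in `w`, that is true of `w` in the standard model. -/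
theorem exists_realize_iff (hN : c ≤ N) (hv : ∀ j, j < w.length ↔ ∃ a, v a = j) :
    (∃ φ : haltLang.Formula α, bdCode v φ = c ∧
        φ.Realize fun a => haltModel.mk X (w.getD (v a) 0)) ↔
      (true, []) ∈ evalTable (c, w, initSeg X N) c ∧
      (false, []) ∈ evalTable (c, w, initSeg X N) c := by
  have hv' : ∀ a, v a < w.length := fun a => (hv _).2 ⟨a, rfl⟩
  constructor
  · rintro ⟨φ, rfl, h⟩
    refine ⟨mem_evalTable_true (p := (_, w, _)) hv' φ rfl (by simp) (by simp), ?_⟩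
    rw [mem_evalTable_false_iff hN hv' φ rfl (by simp) (by simp)]
    rwa [Formula.Realize, Subsingleton.elim default] at h
  · rintro ⟨h1, h2⟩
    obtain ⟨φ, hφ⟩ := exists_bdCode_eq_of_mem_evalTable (p := (c, w, initSeg X N))
      (fun j hj => (hv j).1 hj) (n := 0) rfl h1
    refine ⟨φ, hφ, ?_⟩
    subst hφ
    rw [mem_evalTable_false_iff hN hv' φ rfl (by simp) (by simp)] at h2
    rwa [Formula.Realize, Subsingleton.elim default]

end

/-- Truth in the standard model of `T^X` is decidable from `X`. -/
theorem segDecidable_truth (X : Set ℕ) :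
    SegDecidable X fun k : ℕ × List ℕ => ∃ n, ∃ φ : haltLang.Formula (Fin n), n = k.2.length ∧
      formulaCode φ = k.1 ∧ φ.Realize fun i => haltModel.mk X (k.2.getD i 0) := by
  have h : Primrec fun z : (ℕ × List ℕ) × List Bool =>
      evalTable (z.1.1, z.1.2, z.2) z.1.1 :=
    primrec_evalTable.comp ((Primrec.fst.comp Primrec.fst).pair
      ((Primrec.snd.comp Primrec.fst).pair Primrec.snd)) (Primrec.fst.comp Primrec.fst)
  refine ⟨fun k σ => (true, []) ∈ evalTable (k.1, k.2, σ) k.1 ∧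
    (false, []) ∈ evalTable (k.1, k.2, σ) k.1,
    (primrecPred_mem (Primrec.const _) h).and (primrecPred_mem (Primrec.const _) h),
    Prod.fst, Primrec.fst, fun k N hN => ?_⟩
  refine Iff.trans ?_ (exists_realize_iff hN (v := fun i : Fin k.2.length => (i : ℕ))
    fun j => ⟨fun hj => ⟨⟨j, hj⟩, rfl⟩, fun ⟨a, ha⟩ => ha ▸ a.2⟩)
  exact ⟨fun ⟨n, φ, hn, h⟩ => by subst hn; exact ⟨φ, h⟩, fun ⟨φ, h⟩ => ⟨_, φ, rfl, h⟩⟩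

/-! ### The language, the theory and the standard model in a Scott set -/

section

variable {S : Set (Set ℕ)} {X : Set ℕ}

theorem haltLang_languageIn (hS : IsScottSet S) : LanguageIn S haltLang := by
  constructor
  · have h : {c | ∃ n, ∃ f : haltLang.Functions n, c = Nat.pair n (NumberedLanguage.funCode n f)} =
        {_c : ℕ | False} := Set.ext fun c => ⟨fun ⟨_, f, _⟩ => Empty.elim f, False.elim⟩
    rw [h]
    exact hS.mem_of_primrecPred (PrimrecPred.of_eq (primrecPred_eq_const (Primrec.const 0) 1)
      fun _ => by simp)
  · have h : {c | ∃ n, ∃ R : haltLang.Relations n, c = Nat.pair n (NumberedLanguage.relCode n R)} =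
        {c | c.unpair.1 = 1} := by
      ext c
      constructor
      · rintro ⟨n, R, rfl⟩
        simp only [Set.mem_ofPred_eq, Nat.unpair_pair]
        cases R <;> rfl
      · intro hc
        obtain ⟨R, hR⟩ := haltRelCode_surjective c.unpair.2
        refine ⟨1, R, ?_⟩
        change c = Nat.pair 1 (haltRelCode 1 R)
        rw [hR, ← show c.unpair.1 = 1 from hc, Nat.pair_unpair]
    rw [h]
    exact hS.mem_of_primrecPred (primrecPred_eq_const (primrec_unpair_fst Primrec.id) 1)

theorem haltTheory_decidableIn (hS : IsScottSet S) (hX : X ∈ S) :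
    TheoryDecidableIn S (haltTheory X) := by
  refine Set.mem_of_eq_of_mem (Set.ext fun c => ?_) (hS.mem_of_segDecidable hX
    ((segDecidable_truth X).comp (Primrec.id.pair (Primrec.const []))))
  have h₀ := exists_realize_iff (X := X) (c := c) (N := c) le_rfl (w := [])
    (v := fun e : Empty => e.elim) (by simp)
  have h₁ := exists_realize_iff (X := X) (c := c) (N := c) le_rfl (w := [])
    (v := fun i : Fin 0 => (i : ℕ)) (by simp)
  refine Iff.trans ?_ (h₀.trans (h₁.symm.trans ?_))
  · refine exists_congr fun φ => ?_
    rw [haltTheory_models_iff, and_comm, eq_comm]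
    refine and_congr Iff.rfl ?_
    rw [Sentence.Realize, Subsingleton.elim default]
  · exact ⟨fun ⟨φ, h⟩ => ⟨0, φ, rfl, h⟩, fun ⟨n, φ, hn, h⟩ => by
      obtain rfl : n = 0 := hn
      exact ⟨φ, h⟩⟩

theorem haltModel_modelIn (hS : IsScottSet S) (hX : X ∈ S) : ModelIn S (haltModel X) := by
  constructor
  · exact Set.mem_of_eq_of_mem (Set.ext fun c => by simp [haltModel]) (hS.mem_of_primrecPred
      (PrimrecPred.of_eq (p := fun _ => (0 : ℕ) = 0) (q := fun _ => True)
        (primrecPred_eq_const (Primrec.const 0) 0) fun _ => by simp))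
  · refine Set.mem_of_eq_of_mem (Set.ext fun c => ?_) (hS.mem_of_segDecidable hX
      ((segDecidable_truth X).comp (f := fun c : ℕ =>
        (c.unpair.1, Denumerable.ofNat (List ℕ) c.unpair.2))
        ((primrec_unpair_fst Primrec.id).pair ((Primrec.ofNat _).comp
          (primrec_unpair_snd Primrec.id)))))
    constructor
    · rintro ⟨n, φ, a, h, rfl⟩
      refine ⟨n, φ, ?_, ?_, ?_⟩
      · simp [tupleCode]
      · simp
      · have : (fun i : Fin n => haltModel.mk X ((List.ofFn fun i => (a i : ℕ)).getD i 0)) = a :=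
          funext fun i => Subtype.ext (by simp [haltModel.mk])
        simpa [tupleCode, -List.getD_eq_getElem?_getD, this] using h
    · rintro ⟨n, φ, hn, hφ, h⟩
      refine ⟨n, φ, _, h, ?_⟩
      have hw : (List.ofFn fun i : Fin n =>
          (Denumerable.ofNat (List ℕ) c.unpair.2).getD i 0) =
            Denumerable.ofNat (List ℕ) c.unpair.2 := by
        refine List.ext_getElem (by simpa using hn) fun i h1 h2 => ?_
        simp [h2]
      rw [hφ, tupleCode]
      change c = Nat.pair c.unpair.1 (Encodable.encode (List.ofFn fun i : Fin n =>
          (Denumerable.ofNat (List ℕ) c.unpair.2).getD i 0))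
      rw [hw, Denumerable.encode_ofNat, Nat.pair_unpair]

/-! ### Primality within a Scott set -/

/-- The formula `R(x₀)`. -/
def relFormula (r : HaltRel 1) : haltLang.Formula (Fin 1) :=
  BoundedFormula.rel (L := haltLang) (show haltLang.Relations 1 from r) fun _ => .var (Sum.inl 0)

theorem realize_relFormula {M : Type} [haltLang.Structure M] {r : HaltRel 1} {a : Fin 1 → M} :
    (relFormula r).Realize a ↔ Structure.RelMap (L := haltLang) r ![a 0] := by
  change Structure.RelMap (L := haltLang) r (fun _ => a 0) ↔ _
  rw [show (fun _ => a 0 : Fin 1 → M) = ![a 0] from funext fun i => by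
    rw [Subsingleton.elim i 0]; rfl]

/-- The number which has to be looked up in the complete diagram in order to find out whether `m`
satisfies the relation symbol with number `k`. -/
def diagramQuery (k m : ℕ) : ℕ :=
  Nat.pair (Nat.pair 2 (Nat.pair (Nat.pair 1 k) (Nat.pair (Nat.pair 0 0) 0 + 1)))
    (Nat.pair m 0 + 1)

theorem primrec_diagramQuery {α : Type} [Primcodable α] {k m : α → ℕ} (hk : Primrec k)
    (hm : Primrec m) : Primrec fun a => diagramQuery (k a) (m a) :=
  primrec_pair (primrec_pair (Primrec.const 2) (primrec_pair (primrec_pair (Primrec.const 1) hk)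
    (Primrec.const _))) (Primrec.succ.comp (primrec_pair hm (Primrec.const 0)))

theorem tupleCode_one (a : Fin 1 → ℕ) : tupleCode a = Nat.pair (a 0) 0 + 1 := by
  simp [tupleCode]

theorem diagramQuery_mem {M : NatModel haltLang} {r : HaltRel 1} {m : ℕ} :
    diagramQuery (haltRelCode 1 r) m ∈ diagram M ↔
      ∃ h : m ∈ M.dom, Structure.RelMap (L := haltLang) r ![(⟨m, h⟩ : M.dom)] := by
  constructor
  · rintro ⟨n, φ, a, h, hc⟩
    obtain ⟨h1, h2⟩ := Nat.pair_eq_pair.1 hc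
    obtain rfl : n = 1 := by
      have := congrArg List.length (Encodable.encode_injective
        (show Encodable.encode [m] = Encodable.encode (List.ofFn fun i => (a i : ℕ)) from h2))
      simpa using this.symm
    obtain rfl : m = a 0 := by
      rw [tupleCode_one, Nat.add_right_cancel_iff] at h2
      exact (Nat.pair_eq_pair.1 h2).1
    refine ⟨(a 0).2, ?_⟩
    cases φ with
    | falsum =>
      simp [formulaCode, bdCode] at h1
    | equal t₁ t₂ =>
      simp [formulaCode, bdCode] at h1
    | imp φ ψ =>
      simp [formulaCode, bdCode] at h1
    | all φ =>
      simp [formulaCode, bdCode] at h1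
    | @rel _ l R ts =>
      obtain rfl : l = 1 := by cases R <;> rfl
      obtain ⟨u, hu⟩ := haltLang_term_eq_var (ts 0)
      rw [formulaCode, bdCode_rel _ R u ts hu] at h1
      have h3 := (Nat.pair_eq_pair.1 (Nat.pair_eq_pair.1 (Nat.pair_eq_pair.1 h1).2).1).2
      obtain rfl := haltRelCode_injective 1 h3
      obtain rfl : u = Sum.inl 0 := by
        rcases u with i | i
        · rw [Subsingleton.elim i 0]
        · exact i.elim0
      have h' : Structure.RelMap (L := haltLang) r fun i => (ts i).realize (Sum.elim a default) := h
      rwa [show (fun i => (ts i).realize (Sum.elim a default)) = ![a 0] from funext fun i => by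
        rw [Subsingleton.elim i 0, hu]; rfl] at h'
  · rintro ⟨h, hr⟩
    refine ⟨1, relFormula r, ![⟨m, h⟩], realize_relFormula.2 hr, ?_⟩
    rw [tupleCode_one, formulaCode, relFormula, bdCode_rel _ r (Sum.inl 0) _ rfl]
    rfl

/-- The binary tree of the strings `σ` which, as far as can be seen before stage `σ.length`, choose
for every `i` the correct element of `R_i` as a candidate for `⋃ R_{i,s}`: the larger one if the
`i`-th entry is `true`. The set `D` is the complete diagram of the model. -/
def choiceTree (D : Set ℕ) : Set (List Bool) :=
  {σ | ∀ i < σ.length, ∀ s < σ.length, ∀ m < σ.length, ∀ m' < m,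
    diagramQuery (2 * i) m ∈ D ∧ diagramQuery (2 * i) m' ∈ D →
      (diagramQuery (2 * Nat.pair i s + 1) m ∈ D → σ[i]? = some true) ∧
      (diagramQuery (2 * Nat.pair i s + 1) m' ∈ D → σ[i]? = some false)}

theorem choiceTree_mem_of_prefix {D : Set ℕ} {σ τ : List Bool} (hσ : σ ∈ choiceTree D)
    (hτ : τ <+: σ) : τ ∈ choiceTree D := by
  intro i hi s hs m hm m' hm' h
  have hlen := hτ.length_le
  have : τ[i]? = σ[i]? := by
    obtain ⟨ρ, rfl⟩ := hτ
    rw [List.getElem?_append_left hi]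
  rw [this]
  exact hσ i (by omega) s (by omega) m (by omega) m' hm' h

theorem segDecidable_choiceTree (D : Set ℕ) : SegDecidable D fun σ => σ ∈ choiceTree D := by
  -- The arguments are `σ`, `i`, `s`, `m`, `m'`.
  have hσ : Primrec fun z : (((List Bool × ℕ) × ℕ) × ℕ) × ℕ => z.1.1.1.1 :=
    Primrec.fst.comp (Primrec.fst.comp (Primrec.fst.comp Primrec.fst))
  have hi : Primrec fun z : (((List Bool × ℕ) × ℕ) × ℕ) × ℕ => z.1.1.1.2 :=
    Primrec.snd.comp (Primrec.fst.comp (Primrec.fst.comp Primrec.fst))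
  have hs : Primrec fun z : (((List Bool × ℕ) × ℕ) × ℕ) × ℕ => z.1.1.2 :=
    Primrec.snd.comp (Primrec.fst.comp Primrec.fst)
  have hm : Primrec fun z : (((List Bool × ℕ) × ℕ) × ℕ) × ℕ => z.1.2 :=
    Primrec.snd.comp Primrec.fst
  have hm' : Primrec fun z : (((List Bool × ℕ) × ℕ) × ℕ) × ℕ => z.2 := Primrec.snd
  have hblock := Primrec.nat_mul.comp (Primrec.const 2) hi
  have hstage := Primrec.succ.comp (Primrec.nat_mul.comp (Primrec.const 2) (primrec_pair hi hs))
  have hval := fun b : Bool => SegDecidable.of_primrecPred (X := D)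
    (primrecPred_eq_const (Primrec.list_getElem?.comp hσ hi) (some b))
  have key := ((SegDecidable.mem_oracle (X := D) (primrec_diagramQuery hblock hm)).and
    (SegDecidable.mem_oracle (primrec_diagramQuery hblock hm'))).imp
    (((SegDecidable.mem_oracle (primrec_diagramQuery hstage hm)).imp (hval true)).and
      ((SegDecidable.mem_oracle (primrec_diagramQuery hstage hm')).imp (hval false)))
  exact (((key.forall_lt (n := fun z : ((List Bool × ℕ) × ℕ) × ℕ => z.2) Primrec.snd).forall_lt
    (n := fun z : (List Bool × ℕ) × ℕ => z.1.1.length)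
      (Primrec.list_length.comp (Primrec.fst.comp Primrec.fst))).forall_lt
    (n := fun z : List Bool × ℕ => z.1.length) (Primrec.list_length.comp Primrec.fst)).forall_lt
    (n := fun σ : List Bool => σ.length) Primrec.list_length

/-- The standard model is prime within a Scott set. Which element of `R_i` belongs to `⋃ R_{i,s}`,
if one does, cannot be decided in general, but a path through `choiceTree` guesses correctly
whenever there is something to guess. -/
theorem haltModel_effectivelyPrimeIn (hS : IsScottSet S) :
    EffectivelyPrimeIn S (haltTheory X) (haltModel X) := by
  intro M hM hMS
  set D := diagram M with hD
  have hblock : ∀ {i m : ℕ} (h : m ∈ M.dom), diagramQuery (2 * i) m ∈ D ↔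
      Block i (⟨m, h⟩ : M.dom) := fun {i m} h =>
    (diagramQuery_mem (r := .block i)).trans ⟨fun ⟨_, h⟩ => h, fun k => ⟨h, k⟩⟩
  have hstage : ∀ {i s m : ℕ} (h : m ∈ M.dom), diagramQuery (2 * Nat.pair i s + 1) m ∈ D ↔
      Stage i s (⟨m, h⟩ : M.dom) := fun {i s m} h =>
    (diagramQuery_mem (r := .stage i s)).trans ⟨fun ⟨_, h⟩ => h, fun k => ⟨h, k⟩⟩
  have hdom : ∀ {i m : ℕ}, diagramQuery (2 * i) m ∈ D → m ∈ M.dom := fun {i m} h =>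
    ((diagramQuery_mem (r := .block i)).1 h).1
  choose x y hxy hx hy honly hxs using exists_block_forall_not_stage hM
  have hinf : (choiceTree D).Infinite := by
    refine Set.infinite_of_injective_forall_mem
      (f := initSeg {i | (x i : ℕ) < y i}) (fun k l h => ?_) fun n => ?_
    · simpa [length_initSeg] using congrArg List.length h
    · intro i hi s hs m hm m' hm' ⟨h1, h2⟩
      rw [length_initSeg] at hi
      have hmd := hdom h1
      have hmd' := hdom h2
      have e1 := honly i _ ((hblock hmd).1 h1)
      have e2 := honly i _ ((hblock hmd').1 h2)
      rw [hstage hmd, hstage hmd']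
      have hget : (initSeg {i | (x i : ℕ) < y i} n)[i]? = some (decide ((x i : ℕ) < y i)) := by
        simp [initSeg, hi]
      rw [hget]
      constructor
      · intro hst
        rcases e1 with e1 | e1
        · exact absurd (e1 ▸ hst) (hxs i s)
        rcases e2 with e2 | e2
        · rw [← e1, ← e2]; simpa using hm'
        · exact absurd (congrArg Subtype.val (e1.trans e2.symm)) hm'.ne'
      · intro hst
        rcases e2 with e2 | e2
        · exact absurd (e2 ▸ hst) (hxs i s)
        rcases e1 with e1 | e1
        · rw [← e1, ← e2]; simpa using hm'.le
        · exact absurd (congrArg Subtype.val (e1.trans e2.symm)) hm'.ne'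
  have htree : {c | ∃ σ ∈ choiceTree D, c = Encodable.encode σ} ∈ S := by
    have hdec : Primrec fun c : ℕ => (Encodable.decode (α := List Bool) c).getD [] :=
      Primrec.option_getD.comp Primrec.decode (Primrec.const [])
    refine Set.mem_of_eq_of_mem (Set.ext fun c => ?_) (hS.mem_of_segDecidable hMS.2
      (((segDecidable_choiceTree D).comp hdec).and (SegDecidable.of_primrecPred
        (Primrec.eq.comp Primrec.id (Primrec.encode.comp hdec)))))
    constructor
    · rintro ⟨σ, hσ, rfl⟩
      simpa using hσ
    · rintro ⟨h1, h2⟩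
      exact ⟨_, h1, h2⟩
  obtain ⟨P, hPS, hP⟩ := hS.path_mem _ (fun σ hσ τ hτ => choiceTree_mem_of_prefix hσ hτ) hinf htree
  have hpath : ∀ {i s : ℕ} {m m' : M.dom}, (m' : ℕ) < m → Block i m → Block i m' →
      (Stage i s m → i ∈ P) ∧ (Stage i s m' → i ∉ P) := by
    intro i s m m' hlt hm hm'
    have hi : i < i + s + m + 1 := by omega
    have h := hP (i + s + m + 1) i (by rw [length_initSeg]; omega) s
      (by rw [length_initSeg]; omega) m (by rw [length_initSeg]; omega) m' hlt
      ⟨(hblock m.2).2 hm, (hblock m'.2).2 hm'⟩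
    rw [hstage m.2, hstage m'.2] at h
    simpa [initSeg, hi] using h
  have hsort : ∀ i, ∃ a b : M.dom, (a : ℕ) < b ∧ Block i a ∧ Block i b ∧
      ∀ z, Block i z → z = a ∨ z = b := by
    intro i
    rcases lt_or_gt_of_ne (fun h => hxy i (Subtype.ext h) : (x i : ℕ) ≠ y i) with h | h
    · exact ⟨x i, y i, h, hx i, hy i, honly i⟩
    · exact ⟨y i, x i, h, hy i, hx i, fun z hz => (honly i z hz).symm⟩
  choose a b hab ha hb hab' using hsort
  classical
  let f : ℕ → M.dom := fun n => if n % 2 = 1 ↔ n / 2 ∈ P then b (n / 2) else a (n / 2)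
  have hf0 : ∀ i, f (2 * i) = if i ∈ P then a i else b i := fun i => by
    by_cases h : i ∈ P <;> simp [f, h]
  have hf1 : ∀ i, f (2 * i + 1) = if i ∈ P then b i else a i := fun i => by
    have h1 : (2 * i + 1) % 2 = 1 := by omega
    have h2 : (2 * i + 1) / 2 = i := by omega
    by_cases h : i ∈ P <;> simp [f, h1, h2, h]
  have hne : ∀ i, a i ≠ b i := fun i h => (hab i).ne (congrArg Subtype.val h)
  obtain ⟨g, hg⟩ := exists_elementaryEmbedding hM f
    (fun i => by rw [hf0]; split_ifs; exacts [ha i, hb i])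
    (fun i => by rw [hf1]; split_ifs; exacts [hb i, ha i])
    (fun i => by rw [hf0, hf1]; split_ifs; exacts [hne i, (hne i).symm])
    (fun i s => by
      rw [hf0]
      split_ifs with h
      · exact fun hs => (hpath (hab i) (hb i) (ha i)).2 hs h
      · exact fun hs => h ((hpath (hab i) (hb i) (ha i)).1 hs))
  refine ⟨g, ?_⟩
  -- `f n` is the element of `R_{n/2}` which is, as prescribed by the path, the larger one or not.
  have hgraph : ∀ n k : ℕ, k = f n ↔ diagramQuery (2 * (n / 2)) k ∈ D ∧
      ((n % 2 = 1 ↔ n / 2 ∈ P) ↔ ∃ j < k, diagramQuery (2 * (n / 2)) j ∈ D) := by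
    intro n k
    have hlow : ¬ ∃ j < (a (n / 2) : ℕ), diagramQuery (2 * (n / 2)) j ∈ D := by
      rintro ⟨j, hj, h⟩
      have hj' := hab (n / 2)
      rcases hab' _ _ ((hblock (hdom h)).1 h) with e | e
      · have := congrArg Subtype.val e; dsimp only at this; omega
      · have := congrArg Subtype.val e; dsimp only at this; omega
    have hhigh : ∃ j < (b (n / 2) : ℕ), diagramQuery (2 * (n / 2)) j ∈ D :=
      ⟨_, hab _, (hblock (a (n / 2)).2).2 (ha _)⟩
    constructor
    · rintro rfl
      by_cases h : n % 2 = 1 ↔ n / 2 ∈ P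
      · rw [show f n = b (n / 2) from if_pos h]
        exact ⟨(hblock (b (n / 2)).2).2 (hb _), iff_of_true h hhigh⟩
      · rw [show f n = a (n / 2) from if_neg h]
        exact ⟨(hblock (a (n / 2)).2).2 (ha _), iff_of_false h hlow⟩
    · rintro ⟨h1, h2⟩
      rcases hab' _ _ ((hblock (hdom h1)).1 h1) with e | e
      · obtain rfl : k = a (n / 2) := congrArg Subtype.val e
        rw [show f n = a (n / 2) from if_neg fun h => hlow (h2.1 h)]
      · obtain rfl : k = b (n / 2) := congrArg Subtype.val e
        rw [show f n = b (n / 2) from if_pos (h2.2 hhigh)]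
  have hn : Primrec fun c : ℕ => c.unpair.1 / 2 :=
    Primrec.nat_div.comp (primrec_unpair_fst Primrec.id) (Primrec.const 2)
  have hquery := (SegDecidable.mem_oracle (X := D) (primrec_diagramQuery
    (Primrec.nat_mul.comp (Primrec.const 2) hn) (primrec_unpair_snd Primrec.id))).join_left P
  have hsmaller := ((SegDecidable.mem_oracle (X := D) (primrec_diagramQuery
    (Primrec.nat_mul.comp (Primrec.const 2) (hn.comp Primrec.fst))
    (Primrec.snd (α := ℕ)))).exists_lt (primrec_unpair_snd Primrec.id)).join_left P
  have hodd := SegDecidable.of_primrecPred (X := join D P) (primrecPred_eq_const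
    (Primrec.nat_mod.comp (primrec_unpair_fst Primrec.id) (Primrec.const 2)) 1)
  have hmem := (SegDecidable.mem_oracle (X := P) hn).join_right D
  have hside := hodd.iff hmem
  refine Set.mem_of_eq_of_mem (Set.ext fun c => ?_) (hS.mem_of_segDecidable
    (hS.join_mem _ hMS.2 _ hPS) (hquery.and (hside.iff hsmaller)))
  refine Iff.trans ?_ (hgraph c.unpair.1 c.unpair.2)
  constructor
  · rintro ⟨n, rfl⟩
    rw [Nat.unpair_pair, hg]
  · intro h
    refine ⟨haltModel.mk X c.unpair.1, ?_⟩
    rw [hg]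
    change c = Nat.pair c.unpair.1 (f c.unpair.1)
    rw [← h, Nat.pair_unpair]

/-! ### Failure of effective atomicity -/

theorem segDecidable_haltsBy (X : Set ℕ) :
    SegDecidable X fun k : ℕ × ℕ => HaltsBy X k.1 k.1 k.2 :=
  ⟨fun k σ => HaltsIn σ k.1 k.2, primrecPred_haltsIn Primrec.snd (Primrec.fst.comp Primrec.fst)
    (Primrec.snd.comp Primrec.fst), Prod.snd, Primrec.snd, fun _ _ hN => (haltsIn_initSeg hN).symm⟩

/-- A complete formula satisfied by `2 i + 1` has a Gödel number that bounds the halting time of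
`Φ_i^X(i)`: otherwise exchanging the two elements of `R_i` preserves the formula, which then
decides neither `R_{i,s}` nor its complement, for `s` the halting time. -/
theorem haltsBy_formulaCode {i s : ℕ} (hs : HaltsBy X i i s) {φ : haltLang.Formula (Fin 1)}
    (hφ : IsCompleteFormula (haltTheory X) φ)
    (hr : φ.Realize fun _ => haltModel.mk X (2 * i + 1)) : HaltsBy X i i (formulaCode φ) := by
  classical
  by_contra hc
  have := haltModel_model X
  have hswap : φ.Realize fun _ => haltModel.mk X (2 * i) := by
    have hperm := realize_perm (Equiv.swap (haltModel.mk X (2 * i)) (haltModel.mk X (2 * i + 1)))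
      (c := formulaCode φ) ?_ _ φ le_rfl (fun _ => haltModel.mk X (2 * i + 1)) default
    · rw [Subsingleton.elim (fun j : Fin 0 => _) default, Equiv.swap_apply_right] at hperm
      exact hperm.2 hr
    · intro r z hz
      obtain ⟨z, -⟩ := z
      change Structure.RelMap (L := haltLang) r ![Equiv.swap _ _ (haltModel.mk X z)] ↔
        Structure.RelMap (L := haltLang) r ![haltModel.mk X z]
      by_cases h0 : z = 2 * i
      · subst h0
        rw [Equiv.swap_apply_left]
        cases r with
        | block j =>
          change (2 * i + 1) / 2 = j ↔ 2 * i / 2 = j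
          omega
        | stage j t =>
          change 2 * i + 1 = 2 * j + 1 ∧ HaltsBy X j j t ↔ 2 * i = 2 * j + 1 ∧ HaltsBy X j j t
          refine iff_of_false ?_ (by omega)
          rintro ⟨hij, ht⟩
          obtain rfl : i = j := by omega
          have h1 : 2 * Nat.pair i t + 1 ≤ formulaCode φ := hz
          have h2 := Nat.right_le_pair i t
          exact hc (ht.mono (by omega))
      by_cases h1 : z = 2 * i + 1
      · subst h1
        rw [Equiv.swap_apply_right]
        cases r with
        | block j =>
          change 2 * i / 2 = j ↔ (2 * i + 1) / 2 = j
          omega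
        | stage j t =>
          change 2 * i = 2 * j + 1 ∧ HaltsBy X j j t ↔ 2 * i + 1 = 2 * j + 1 ∧ HaltsBy X j j t
          refine iff_of_false (by omega) ?_
          rintro ⟨hij, ht⟩
          obtain rfl : i = j := by omega
          have h1 : 2 * Nat.pair i t + 1 ≤ formulaCode φ := hz
          have h2 := Nat.right_le_pair i t
          exact hc (ht.mono (by omega))
      rw [Equiv.swap_apply_of_ne_of_ne (mt haltModel.mk_inj.1 h0) (mt haltModel.mk_inj.1 h1)]
  rcases hφ (relFormula (.stage i s)) with ⟨h, -⟩ | ⟨h, -⟩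
  · have h1 := realize_relFormula.1 (Formula.realize_imp.1
      (h.realize_formula (haltModel X).dom) hswap)
    have h2 : 2 * i = 2 * i + 1 := (haltModel.stage_iff.1 h1).1
    omega
  · refine Formula.realize_not.1 (Formula.realize_imp.1
      (h.realize_formula (haltModel X).dom) hr) (realize_relFormula.2 ?_)
    exact haltModel.stage_iff.2 ⟨rfl, hs⟩

theorem haltModel_not_effectivelyAtomicIn (hS : IsScottSet S) (hX : X ∈ S) (hX' : jump X ∉ S) :
    ¬ EffectivelyAtomicIn S (haltTheory X) (haltModel X) := by
  rintro ⟨g, hgS, hg⟩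
  set G := {c | ∃ x, c = Nat.pair x (g x)} with hG
  have hGmem : ∀ {x y}, Nat.pair x y ∈ G ↔ y = g x := by
    intro x y
    constructor
    · rintro ⟨z, hz⟩
      obtain ⟨rfl, h⟩ := Nat.pair_eq_pair.1 hz
      exact h
    · rintro rfl
      exact ⟨x, rfl⟩
  -- The code of the tuple `(2 i + 1)`.
  have hcode : Primrec fun k : ℕ × ℕ => Nat.pair (2 * k.1 + 1) 0 + 1 :=
    Primrec.succ.comp (primrec_pair (Primrec.succ.comp (Primrec.nat_mul.comp (Primrec.const 2)
      Primrec.fst)) (Primrec.const 0))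
  refine hX' (hS.reducible_mem _ (hS.join_mem _ hgS _ hX) _ (SegDecidable.setReducible_of_search
    ((SegDecidable.mem_oracle (X := G) (primrec_pair hcode Primrec.snd)).join_left X)
    ((segDecidable_haltsBy X).join_right G)
    (fun i => ⟨g (Nat.pair (2 * i + 1) 0 + 1), hGmem.2 rfl⟩) fun i y hy => ?_))
  obtain ⟨φ, hφ, hcomp, hr⟩ := hg 1 fun _ => haltModel.mk X (2 * i + 1)
  rw [tupleCode_one] at hφ
  have hy' : y = formulaCode φ := (hGmem.1 hy).trans hφ
  refine ⟨fun ⟨s, hs⟩ => ?_, fun h => ⟨_, h⟩⟩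
  rw [hy']
  exact haltsBy_formulaCode hs hcomp hr

end

end ScottModels

theorem mainTheorem6 (S : Set (Set ℕ)) (hS : ScottModels.IsScottSet S)
    (X : Set ℕ) (hX : X ∈ S) (hX' : ScottModels.jump X ∉ S) :
    ¬ ScottModels.EffectivelyPrimeImpliesAtomicIn S ∧
    ScottModels.LanguageIn S ScottModels.haltLang ∧
    (ScottModels.haltTheory X).IsComplete ∧
    ScottModels.TheoryDecidableIn S (ScottModels.haltTheory X) ∧
    ∃ A : ScottModels.NatModel ScottModels.haltLang,
      ScottModels.IsPrimeModel (ScottModels.haltTheory X) A ∧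
      ScottModels.ModelIn S A ∧
      ScottModels.EffectivelyPrimeIn S (ScottModels.haltTheory X) A ∧
      ¬ ScottModels.EffectivelyAtomicIn S (ScottModels.haltTheory X) A := by
  have hL := ScottModels.haltLang_languageIn hS
  have hC := ScottModels.haltTheory_isComplete X
  have hD := ScottModels.haltTheory_decidableIn hS hX
  have hM := ScottModels.haltModel_modelIn hS hX
  have hP := ScottModels.haltModel_effectivelyPrimeIn (X := X) hS
  have hA := ScottModels.haltModel_not_effectivelyAtomicIn hS hX hX'
  exact ⟨fun h => hA (h _ hL _ hC hD _ (ScottModels.haltModel_model X) hM hP), hL, hC, hD,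
    ScottModels.haltModel X, ScottModels.haltModel_isPrimeModel X, hM, hP, hA⟩
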